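/- Let $k$ be a nonzero semisimple commutative ring and let $\mathcal{C}$ be a small EI category, i.e. a small category in which every endomorphism is an isomorphism. For an object $c$ let $G_c=\mathcal{C}(c,c)$, which is a group. Write $c<d$ if $\mathcal{C}(c,d)\neq\emptyset$ and $c\not\cong d$. A left $\mathcal{C}$-module is a covariant functor from $\mathcal{C}$ to the category of $k$-modules. The category of left $\mathcal C$-modules is called hereditary if every submodule of a projective left $\mathcal C$-module is projective (equivalently, its global dimension is at most $1$), and $kG_c$ is called hereditary if the same holds for left $kG_c$-modules. A non-invertible morphism of $\mathcal{C}$ is called unfactorisable if it is not the composition of two non-invertible morphisms. Suppose that $\mathcal{C}$ has the finite factorisation property (FFP): every non-invertible morphism is a composition of finitely many unfactorisable morphisms. Then the category of left $\mathcal{C}$-modules is hereditary if and only if the following three conditions hold: 1. The group ring $kG_c$ is hereditary for every object $c$ of $\mathcal{C}$. 2. $\mathcal{C}$ has the unique factorisation property (UFP): whenever $x=x_0\xrightarrow{\alpha_1}x_1\to\cdots\xrightarrow{\alpha_n}x_n=y$ and $x=x_0'\xrightarrow{\alpha_1'}x_1'\to\cdots\xrightarrow{\alpha_{n'}'}x_{n'}'=y$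 are two chains of unfactorisable morphisms with the same composition, then $n=n'$ and there are isomorphisms $h_i\colon x_i\to x_i'$ for $0\le i\le n$, with $h_0=\mathrm{id}_x$ and $h_n=\mathrm{id}_y$, such that $h_i\alpha_i=\alpha_i'h_{i-1}$ for $1\le i\le n$. 3. Conditions $(\mathrm{A}_d)$ and $(\mathrm{B}_d)$ hold. Here a set is called $k^\times$-finite if it is finite and its cardinality is invertible in $k$, and the biset stabilisers in $\mathcal{C}(c,d)$ are the stabilisers $H_f=\{(h,g)\in G_d\times G_c^{\mathrm{op}} : h f g=f\}$ of the morphisms $f\in\mathcal{C}(c,d)$. - $(\mathrm{A}_d)$ For all $c<d$, every finitely generated subgroup of every biset stabiliser in $\mathcal{C}(c,d)$ is $k^\times$-finite. - $(\mathrm{B}_d)$ For all $c<d$ and every biset stabiliser $H$ in $\mathcal{C}(c,d)$, the image of $H$ under the projection $G_d\times G_c^{\mathrm{op}}\to G_d$ is $k^\times$-finite. -/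

import Mathlib

open CategoryTheory

universe u v w

-- Elaborate `x ⟶ y` with the quiver structure underlying the category structure.
attribute [local instance 2000] CategoryStruct.toQuiver

namespace EITheory

/-! ### EI categories and their automorphism groups -/

/-- An EI category: every endomorphism is an isomorphism. -/
class IsEI (C : Type u) [Category.{v} C] : Prop where
  isIso_of_end : ∀ {c : C} (f : c ⟶ c), IsIso f

/-- In an EI category, `End c` (with `f * g = f ∘ g`, i.e. `g ≫ f`) is a group, denoted `G_c`. -/
noncomputable instance endGroup {C : Type u} [Category.{v} C] [IsEI C] (c : C) :
    Group (End c) where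
  __ := (inferInstance : Monoid (End c))
  inv f := @CategoryTheory.inv _ _ c c f (IsEI.isIso_of_end f)
  inv_mul_cancel f := @IsIso.hom_inv_id _ _ c c f (IsEI.isIso_of_end f)

/-! ### Factorisation properties -/

section Factorisation

variable {C : Type u} [Category.{v} C]

/-- A morphism is unfactorisable if it is non-invertible and it is not the composition of two
non-invertible morphisms. -/
def Unfactorisable {x y : C} (f : x ⟶ y) : Prop :=
  ¬ IsIso f ∧ ∀ (z : C) (g : x ⟶ z) (h : z ⟶ y), g ≫ h = f → IsIso g ∨ IsIso h

/-- Finite chains `x = x₀ ⟶ x₁ ⟶ ⋯ ⟶ xₙ = y` of morphisms, `n ≥ 0`. -/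
inductive Chain (x : C) : C → Type (max u v)
  | nil : Chain x x
  | cons {y z : C} (p : Chain x y) (α : y ⟶ z) : Chain x z

/-- The composition of a chain of morphisms. -/
def Chain.comp {x : C} : ∀ {y : C}, Chain x y → (x ⟶ y)
  | _, .nil => 𝟙 x
  | _, .cons p α => p.comp ≫ α

/-- All morphisms in the chain are unfactorisable. -/
def Chain.IsUnfactorisable {x : C} : ∀ {y : C}, Chain x y → Prop
  | _, .nil => True
  | _, .cons p α => p.IsUnfactorisable ∧ Unfactorisable α

/-- `Ladder p p' h`: the chains `p : x = x₀ ⟶ ⋯ ⟶ xₙ` and `p' : x = x'₀ ⟶ ⋯ ⟶ x'ₙ` with the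
same start have the same length, and there are isomorphisms `hᵢ : xᵢ ≅ x'ᵢ` with `h₀ = id` and
`hₙ = h` which make all squares of the ladder between `p` and `p'` commute. -/
inductive Ladder {x : C} : ∀ {y y' : C}, Chain x y → Chain x y' → (y ≅ y') → Prop
  | nil : Ladder Chain.nil Chain.nil (Iso.refl x)
  | cons {y y' z z' : C} {p : Chain x y} {p' : Chain x y'} {h : y ≅ y'}
      (hp : Ladder p p' h) (α : y ⟶ z) (α' : y' ⟶ z') (h' : z ≅ z')
      (comm : α ≫ h'.hom = h.hom ≫ α') :
      Ladder (p.cons α) (p'.cons α') h'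

variable (C)

/-- The finite factorisation property: every non-invertible morphism is a composition of
finitely many unfactorisable morphisms. -/
def FFP : Prop :=
  ∀ (x y : C) (f : x ⟶ y), ¬ IsIso f → ∃ p : Chain x y, p.IsUnfactorisable ∧ p.comp = f

/-- The unique factorisation property: any two chains of unfactorisable morphisms from `x` to `y`
with the same composition are related by a ladder of isomorphisms which is the identity at `x`
and at `y`; in particular they have the same length. -/
def UFP : Prop :=
  ∀ (x y : C) (p p' : Chain x y),
    p.IsUnfactorisable → p'.IsUnfactorisable → p.comp = p'.comp → Ladder p p' (Iso.refl y)

end Factorisation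

/-! ### Biset stabilisers -/

/-- A set is `kˣ`-finite if it is finite and its cardinality is invertible in `k`. -/
def UnitFinite (k : Type w) [CommRing k] (X : Type v) : Prop :=
  Finite X ∧ IsUnit (Nat.card X : k)

/-- A subgroup is locally `kˣ`-finite if all its finitely generated subgroups are `kˣ`-finite. -/
def LocallyUnitFinite (k : Type w) [CommRing k] {G : Type v} [Group G] (H : Subgroup G) : Prop :=
  ∀ K : Subgroup G, K ≤ H → K.FG → UnitFinite k K

section Stabilisers

variable {C : Type u} [Category.{v} C] [IsEI C]

/-- The biset structure on `C(c,d)`: the left action of `G_d × G_cᵒᵖ` given by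
`(h, g) • f = h ∘ f ∘ g`. -/
noncomputable abbrev bisetAction (c d : C) : MulAction (End d × (End c)ᵐᵒᵖ) (c ⟶ d) where
  smul a f := (show c ⟶ c from a.2.unop) ≫ f ≫ (show d ⟶ d from a.1)
  one_smul f := by
    change 𝟙 c ≫ f ≫ 𝟙 d = f
    simp
  mul_smul a b f := by
    change ((show c ⟶ c from a.2.unop) ≫ (show c ⟶ c from b.2.unop)) ≫ f ≫
        ((show d ⟶ d from b.1) ≫ (show d ⟶ d from a.1)) =
      (show c ⟶ c from a.2.unop) ≫
        ((show c ⟶ c from b.2.unop) ≫ f ≫ (show d ⟶ d from b.1)) ≫ (show d ⟶ d from a.1)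
    simp only [Category.assoc]

/-- The stabiliser of `f : c ⟶ d` in `G_d × G_cᵒᵖ`. When `f` varies over `C(c,d)`, these are
exactly the subgroups `H` such that `(G_d × G_cᵒᵖ) / H` occurs as an orbit of `C(c,d)`. -/
noncomputable def bisetStabiliser {c d : C} (f : c ⟶ d) : Subgroup (End d × (End c)ᵐᵒᵖ) :=
  @MulAction.stabilizer _ _ _ (bisetAction c d) f

/-- The strict order on isomorphism classes of objects, `[c] < [d]`. -/
def StrictlyBelow (c d : C) : Prop :=
  Nonempty (c ⟶ d) ∧ ¬ IsIsomorphic c d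

variable (k : Type w) [CommRing k] (C)

/-- Condition `(A_d)`: for all `c < d`, all biset stabilisers in `C(c,d)` are locally
`kˣ`-finite. -/
def ConditionA : Prop :=
  ∀ c d : C, StrictlyBelow c d → ∀ f : c ⟶ d, LocallyUnitFinite k (bisetStabiliser f)

/-- Condition `(B_d)`: for all `c < d`, the projections to `G_d` of all biset stabilisers
in `C(c,d)` are `kˣ`-finite. -/
def ConditionB : Prop :=
  ∀ c d : C, StrictlyBelow c d → ∀ f : c ⟶ d,
    UnitFinite k ((bisetStabiliser f).map (MonoidHom.fst (End d) (End c)ᵐᵒᵖ))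

end Stabilisers

/-! ### Hereditary module categories -/

/-- A category is hereditary if every subobject of a projective object is projective. -/
def IsHereditary (A : Type u) [Category.{v} A] : Prop :=
  ∀ (P Q : A) (i : Q ⟶ P), Mono i → Projective P → Projective Q

/-- The category of left `C`-modules over `k`: covariant functors from `C` to `k`-modules. -/
abbrev LeftModules (k : Type w) [CommRing k] (C : Type u) [Category.{v} C] :=
  C ⥤ ModuleCat.{max u v w} k

/-- The category of left modules over the group ring `k G_c`. -/
abbrev GroupRingModules (k : Type w) [CommRing k] {C : Type u} [Category.{v} C] [IsEI C] (c : C) :=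
  ModuleCat.{max u v w} (MonoidAlgebra k (End c))

end EITheory

/-!
Let `P_x = kC(x, -)`, and let `act X f : X(x) → X(y)` be the action of `f : x ⟶ y` on a left module
`X`. Everything rests on lifting problems solved by hand; neither derived functors nor tensor
products over group rings occur.

**Lifting at an object.** For a representation `A` of `G_d`, the equivariant functions `C(x, d) → A`
(possibly only those supported on the isomorphisms) form a left module in `x`, and morphisms from
`P` to it are equivariant maps `P(d) → A` (which kill the images of the non-isomorphisms).
Equivariant functions lift along surjections `A → B` if stabilisers have invertible order, by
averaging. Thus a projective left module `P` yields lifting properties of the representation `P(d)`: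
`exists_lift_at`.

**Necessity.** In each case a suitable submodule `N` of a free left module is projective by
assumption, and the existence of a section or of a lift gives the claim.
* `IsHereditary.groupRingModules`: `N` is generated by a submodule of the value of a free module at
  `c`.
* `IsHereditary.uniqueFirstFactors`: `N` is the radical of `P_x`, spanned by the non-isomorphisms.
  It is covered by the free `k`-modules on the factorisations `u ≫ f` with `u` unfactorisable, up to
  isomorphism, and a section of this covering shows that a morphism has only one such factorisation.
  The unique factorisation property follows by induction: `UniqueFirstFactors.ufp`.
* `IsHereditary.locallyUnitFinite_rightStabiliser`: `N` is generated by `(gᵢ - 1)ᵢ` in `⨁ᵢ P_c`.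
* `IsHereditary.unitFinite_of_unfactorisable`: `N` is the kernel of the augmentation from `P_c` to
  the trivial module concentrated at `c`.

The last two give conditions (A) and (B): a finitely generated subgroup of a biset stabiliser is an
extension of its projection to `G_d`, which is `kˣ`-finite by (B), by a subgroup of finite index,
which is finitely generated by Schreier's lemma and lies in a right stabiliser.

**Sufficiency.** Let `Q` be a submodule of a projective module `P`, and lift a morphism `Q → X'`
along an epimorphism `X → X'` with kernel `Y`. By (B) the representations `P(c)` are projective,
hence so are the `Q(c)`, and there are lifts `l x : Q(x) → X(x)` commuting with isomorphisms. For a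
non-isomorphism `u` the map `δ u = u l - l u : Q(x) → Y(y)` is equivariant under the stabiliser of
`u`, and (A), (B) and semisimplicity of `k` allow one to extend it to `P(x)` equivariantly
(`exists_equivariant_extension`). By unique factorisation the extended maps, given on unfactorisable
morphisms, determine an extension of `P` by `Y` (`exists_derivation`); as `P` is projective it
splits (`exists_coboundary`), and the splitting corrects the `l x` to a morphism of left modules.
-/

namespace EITheory

/-! ### Choices compatible with isomorphisms -/

/-- Let `E a b` be the arrows of a groupoid acting on a family of types `S a`. If every `S a` has
an element fixed by all loops at `a`, then these elements can be chosen compatibly with all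
arrows: choose one representative in each component and transport. -/
theorem exists_equivariant_choice {ι : Type*} (E : ι → ι → Type*) (S : ι → Type*)
    (act : ∀ {a b}, E a b → S a → S b) (refl : ∀ a, E a a) (symm : ∀ {a b}, E a b → E b a)
    (trans : ∀ {a b c}, E a b → E b c → E a c)
    (act_symm : ∀ {a b} (e : E a b) (s : S a), act (symm e) (act e s) = s)
    (act_trans : ∀ {a b c} (e : E a b) (f : E b c) (s : S a), act (trans e f) s = act f (act e s))
    (h : ∀ a, ∃ s : S a, ∀ e : E a a, act e s = s) :
    ∃ s : ∀ a, S a, ∀ a b (e : E a b), act e (s a) = s b := by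
  choose s₀ hs₀ using h
  let r : Setoid ι := ⟨fun a b => Nonempty (E a b), fun a => ⟨refl a⟩, fun ⟨e⟩ => ⟨symm e⟩,
    fun ⟨e⟩ ⟨f⟩ => ⟨trans e f⟩⟩
  have e₀ : ∀ a, E (Quotient.out (Quotient.mk r a)) a := fun a => (Quotient.mk_out (s := r) a).some
  have key : ∀ (x y : ι) (_ : x = y) (a b : ι) (ea : E x a) (eb : E y b) (e : E a b),
      act e (act ea (s₀ x)) = act eb (s₀ y) := by
    rintro x _ rfl a b ea eb e
    refine (Function.LeftInverse.injective fun s => act_symm (symm eb) s) ?_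
    rw [act_symm, ← act_trans, ← act_trans, hs₀]
  refine ⟨fun a => act (e₀ a) (s₀ _), fun a b e => key _ _ ?_ _ _ _ _ _⟩
  rw [Quotient.sound (s := r) (a := a) (b := b) ⟨e⟩]

/-! ### Unit-finite groups -/

section UnitFinite

variable {k : Type w} [CommRing k]

theorem UnitFinite.of_dvd {X Y : Type*} [Finite X] (h : Nat.card X ∣ Nat.card Y)
    (hY : UnitFinite k Y) : UnitFinite k X :=
  ⟨inferInstance, isUnit_of_dvd_unit (Nat.cast_dvd_cast h) hY.2⟩

theorem UnitFinite.of_equiv {X Y : Type*} (e : X ≃ Y) (hY : UnitFinite k Y) : UnitFinite k X :=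
  have := hY.1
  have := Finite.of_equiv _ e.symm
  .of_dvd (Nat.card_congr e).dvd hY

theorem UnitFinite.of_le {G : Type*} [Group G] {H K : Subgroup G} (h : H ≤ K)
    (hK : UnitFinite k K) : UnitFinite k H :=
  have := hK.1
  have : Finite H := Finite.of_injective _ (Subgroup.inclusion_injective h)
  .of_dvd (Subgroup.card_dvd_of_le h) hK

theorem UnitFinite.of_subsingleton (X : Type*) [Subsingleton X] [Nonempty X] : UnitFinite k X :=
  ⟨inferInstance, by simp⟩

theorem UnitFinite.of_ker_range {G G' : Type*} [Group G] [Group G'] (f : G →* G')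
    (h₁ : UnitFinite k f.ker) (h₂ : UnitFinite k f.range) : UnitFinite k G := by
  have := h₁.1
  have := h₂.1
  have e := QuotientGroup.quotientKerEquivRange f
  have : Finite (G ⧸ f.ker) := Finite.of_equiv _ e.symm.toEquiv
  have hfin : Finite G :=
    Finite.of_equiv _ (Subgroup.groupEquivQuotientProdSubgroup (s := f.ker)).symm
  refine ⟨hfin, ?_⟩
  rw [Subgroup.card_eq_card_quotient_mul_card_subgroup f.ker, Nat.card_congr e.toEquiv,
    Nat.cast_mul]
  exact h₂.2.mul h₁.2

/-- A group acting freely on a set `X` is `kˣ`-finite as soon as some finitely supported invariant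
function on `X` has sum `1`: the sum is a multiple of the order of the group. -/
theorem UnitFinite.of_invariant_finsupp [Nontrivial k] {K X : Type*} [Group K] [MulAction K X]
    (hfree : ∀ (g : K) (x : X), g • x = x → g = 1) (a : X →₀ k)
    (ha : ∀ (g : K) (x : X), a (g • x) = a x) (hsum : a.sum (fun _ r => r) = 1) :
    UnitFinite k K := by
  classical
  have hinj : ∀ x : X, Function.Injective fun g : K => g • x := fun x g h hgh => by
    have := hfree (h⁻¹ * g) x (by simp only at hgh; rw [mul_smul, hgh, inv_smul_smul])
    exact (inv_mul_eq_one.1 this).symm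
  have hne : a ≠ 0 := by
    rintro rfl
    simp at hsum
  obtain ⟨x₀, hx₀⟩ := Finsupp.ne_iff.1 hne
  have hmem : ∀ x ∈ a.support, ∀ g : K, g • x ∈ a.support := fun x hx g => by
    rw [Finsupp.mem_support_iff, ha]
    exact Finsupp.mem_support_iff.1 hx
  have hfin : Finite K := by
    refine Finite.of_injective (fun g : K => (⟨g • x₀, hmem x₀ (by simpa using hx₀) g⟩ : a.support))
      fun g h hgh => hinj x₀ (congrArg Subtype.val hgh)
  have := Fintype.ofFinite K
  refine ⟨hfin, isUnit_of_dvd_one ?_⟩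
  rw [← hsum, Finsupp.sum,
    ← Finset.sum_fiberwise_of_maps_to (t := a.support.image (Quotient.mk (MulAction.orbitRel K X)))
      (g := Quotient.mk (MulAction.orbitRel K X)) (fun x hx => Finset.mem_image_of_mem _ hx)]
  refine Finset.dvd_sum fun o ho => ?_
  obtain ⟨x, hx, rfl⟩ := Finset.mem_image.1 ho
  have hfib : a.support.filter (fun y => Quotient.mk (MulAction.orbitRel K X) y = Quotient.mk _ x) =
      Finset.univ.image fun g : K => g • x := by
    ext y
    simp only [Finset.mem_filter, Finset.mem_image, Finset.mem_univ, true_and]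
    constructor
    · rintro ⟨_, h⟩
      exact MulAction.orbitRel_apply.1 (Quotient.exact h)
    · rintro ⟨g, rfl⟩
      exact ⟨hmem x hx g, Quotient.sound (MulAction.orbitRel_apply.2 ⟨g, rfl⟩)⟩
  rw [hfib, Finset.sum_image fun g _ h _ hgh => hinj x hgh]
  simp [ha, Nat.card_eq_fintype_card]

end UnitFinite

/-! ### Averaging and extension of equivariant maps -/

section Averaging

variable {k : Type w} [CommRing k] {H : Type*} [Group H]

/-- If `L ≤ H` has finite index invertible in `k`, an `L`-fixed vector over an `H`-fixed vector can
be averaged to an `H`-fixed one. -/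
theorem exists_fixed_lift {V W : Type*} [AddCommGroup V] [Module k V] [AddCommGroup W] [Module k W]
    (ρ : Representation k H V) (σ : Representation k H W) (q : V →ₗ[k] W)
    (hq : ∀ h v, q (ρ h v) = σ h (q v)) (L : Subgroup H) (hL : UnitFinite k (H ⧸ L))
    (v : V) (hv : ∀ l ∈ L, ρ l v = v) (hw : ∀ h, σ h (q v) = q v) :
    ∃ v', q v' = q v ∧ ∀ h, ρ h v' = v' := by
  obtain ⟨hfin, c, hc⟩ := hL
  have := Fintype.ofFinite (H ⧸ L)
  let t : H ⧸ L → V := Quotient.lift (fun h => ρ h v) fun a b hab => by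
    have h1 := hv _ (QuotientGroup.leftRel_apply.1 hab)
    calc ρ a v = ρ a (ρ (a⁻¹ * b) v) := by rw [h1]
      _ = ρ b v := by rw [← Module.End.mul_apply, ← map_mul, mul_inv_cancel_left]
  have ht : ∀ (h : H) (x : H ⧸ L), ρ h (t x) = t (h • x) := by
    rintro h ⟨x⟩
    change ρ h (ρ x v) = ρ (h * x) v
    rw [map_mul, Module.End.mul_apply]
  have hqt : ∀ x, q (t x) = q v := by
    rintro ⟨x⟩
    exact (hq x v).trans (hw x)
  refine ⟨(↑c⁻¹ : k) • ∑ x, t x, ?_, fun h => ?_⟩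
  · rw [map_smul, map_sum, Finset.sum_congr rfl fun x _ => hqt x, Finset.sum_const,
      Finset.card_univ, ← Nat.cast_smul_eq_nsmul k, smul_smul, ← Nat.card_eq_fintype_card, ← hc,
      Units.inv_mul, one_smul]
  · rw [map_smul, map_sum, Finset.sum_congr rfl fun x _ => ht h x]
    congr 1
    exact (MulAction.bijective h).sum_comp t

variable {P N Y : Type*} [AddCommGroup P] [Module k P] [AddCommGroup N] [Module k N]
  [AddCommGroup Y] [Module k Y]

/-- The span of the vectors `ρ g p - p` with `g ∈ K`; the quotient by it is the module of
`K`-coinvariants. -/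
def augmentationSpan (ρ : Representation k H P) (K : Subgroup H) : Submodule k P :=
  Submodule.span k {x | ∃ g ∈ K, ∃ p, x = ρ g p - p}

theorem augmentationSpan_mono (ρ : Representation k H P) {K L : Subgroup H} (h : K ≤ L) :
    augmentationSpan ρ K ≤ augmentationSpan ρ L :=
  Submodule.span_mono fun _ ⟨g, hg, p, hp⟩ => ⟨g, h hg, p, hp⟩

theorem exists_fg_mem_augmentationSpan (ρ : Representation k H P) (L : Subgroup H) {x : P}
    (hx : x ∈ augmentationSpan ρ L) :
    ∃ K : Subgroup H, K ≤ L ∧ K.FG ∧ x ∈ augmentationSpan ρ K := by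
  induction hx using Submodule.span_induction with
  | mem x h =>
    obtain ⟨g, hg, p, rfl⟩ := h
    exact ⟨Subgroup.closure {g}, (Subgroup.closure_le _).2 (by simpa using hg),
      ⟨{g}, by simp⟩, Submodule.subset_span ⟨g, Subgroup.subset_closure rfl, p, rfl⟩⟩
  | zero => exact ⟨⊥, bot_le, ⟨∅, by simp⟩, zero_mem _⟩
  | add x y _ _ hx hy =>
    obtain ⟨K, hK, hK', hx⟩ := hx
    obtain ⟨K₂, hK₂, hK₂', hy⟩ := hy
    exact ⟨K ⊔ K₂, sup_le hK hK₂, hK'.sup hK₂',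
      add_mem (augmentationSpan_mono ρ le_sup_left hx) (augmentationSpan_mono ρ le_sup_right hy)⟩
  | smul a x _ hx =>
    obtain ⟨K, hK, hK', hx⟩ := hx
    exact ⟨K, hK, hK', Submodule.smul_mem _ a hx⟩

theorem sum_eq_zero_of_mem_augmentationSpan (ρ : Representation k H P) (K : Subgroup H) [Fintype K]
    {x : P} (hx : x ∈ augmentationSpan ρ K) : ∑ g : K, ρ g x = 0 := by
  induction hx using Submodule.span_induction with
  | mem x h =>
    obtain ⟨g, hg, p, rfl⟩ := h
    have := (Group.mulRight_bijective (⟨g, hg⟩ : K)).sum_comp fun h : K => ρ h p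
    simp only [map_sub, Finset.sum_sub_distrib]
    rw [← this, sub_eq_zero]
    refine Finset.sum_congr rfl fun h _ => ?_
    simp
  | zero => simp
  | add x y _ _ hx hy => simp only [map_add, Finset.sum_add_distrib, hx, hy, add_zero]
  | smul a x _ hx => simp only [map_smul, ← Finset.smul_sum, hx, smul_zero]

/-- Every linear map between modules over a semisimple ring has a generalised inverse. -/
theorem exists_generalisedInverse [IsSemisimpleRing k] (f : N →ₗ[k] P) :
    ∃ g : P →ₗ[k] N, ∀ n, f (g (f n)) = f n := by
  obtain ⟨π, hπ⟩ := IsSemisimpleModule.extension_property (LinearMap.range f).subtype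
    (Submodule.subtype_injective _) LinearMap.id
  obtain ⟨s, hs⟩ := IsSemisimpleModule.lifting_property f.rangeRestrict f.surjective_rangeRestrict
    LinearMap.id
  refine ⟨s ∘ₗ π, fun n => ?_⟩
  have h1 : π (f n) = f.rangeRestrict n := LinearMap.congr_fun hπ (f.rangeRestrict n)
  have h2 := congrArg Subtype.val (LinearMap.congr_fun hs (f.rangeRestrict n))
  simpa [h1] using h2

/-- Extension of equivariant maps. Let `L = ker p` act trivially on `Y`. An equivariant map
`δ : N → Y` kills `N ∩ I_L P` because finitely generated subgroups of `L` have invertible order,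
hence it extends to an `L`-invariant linear map on `P`, which is then averaged over `H / L`. -/
theorem exists_equivariant_extension [IsSemisimpleRing k] {G : Type*} [Group G] (p : H →* G)
    (hH : ∀ K : Subgroup H, K.FG → UnitFinite k K) (hp : UnitFinite k p.range)
    (ρ : Representation k H P) (σ : Representation k H N) (τ : Representation k H Y)
    (hτ : ∀ l ∈ p.ker, ∀ y, τ l y = y)
    (i : N →ₗ[k] P) (hi : Function.Injective i) (hiρ : ∀ h n, i (σ h n) = ρ h (i n))
    (δ : N →ₗ[k] Y) (hδ : ∀ h n, δ (σ h n) = τ h (δ n)) :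
    ∃ T : P →ₗ[k] Y, (∀ n, T (i n) = δ n) ∧ ∀ h x, T (ρ h x) = τ h (T x) := by
  have hker : ∀ n, i n ∈ augmentationSpan ρ p.ker → δ n = 0 := by
    intro n hn
    obtain ⟨K, hK, hKfg, hn⟩ := exists_fg_mem_augmentationSpan ρ _ hn
    obtain ⟨hfin, c, hc⟩ := hH K hKfg
    have := Fintype.ofFinite K
    have h1 : i (∑ g : K, σ g n) = 0 := by
      rw [map_sum, ← sum_eq_zero_of_mem_augmentationSpan ρ K hn]
      exact Finset.sum_congr rfl fun g _ => hiρ _ _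
    have h2 : ∑ g : K, σ g n = 0 := hi (h1.trans (map_zero i).symm)
    have h3 : (c : k) • δ n = 0 := by
      rw [hc, Nat.cast_smul_eq_nsmul, Nat.card_eq_fintype_card, ← Finset.card_univ,
        ← Finset.sum_const, ← map_zero δ, ← h2, map_sum]
      refine Finset.sum_congr rfl fun g _ => ?_
      rw [hδ, hτ _ (hK g.2)]
    rw [← one_smul k (δ n), ← c.inv_mul, mul_smul, h3, smul_zero]
  obtain ⟨θ, hθ⟩ := exists_generalisedInverse ((augmentationSpan ρ p.ker).mkQ ∘ₗ i)
  let T₀ : P →ₗ[k] Y := δ ∘ₗ θ ∘ₗ (augmentationSpan ρ p.ker).mkQ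
  have hT₀ : ∀ n, T₀ (i n) = δ n := by
    intro n
    rw [← sub_eq_zero]
    change δ (θ ((augmentationSpan ρ p.ker).mkQ (i n))) - δ n = 0
    rw [← map_sub]
    apply hker
    refine (Submodule.Quotient.mk_eq_zero _).1 ?_
    change (augmentationSpan ρ p.ker).mkQ (i (_ - n)) = 0
    rw [map_sub, map_sub, sub_eq_zero]
    exact hθ n
  have hT₀' : ∀ l ∈ p.ker, ∀ x, T₀ (ρ l x) = T₀ x := by
    intro l hl x
    change δ (θ ((augmentationSpan ρ p.ker).mkQ (ρ l x))) =
      δ (θ ((augmentationSpan ρ p.ker).mkQ x))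
    congr 2
    rw [← sub_eq_zero, ← map_sub, ← LinearMap.mem_ker, Submodule.ker_mkQ]
    exact Submodule.subset_span ⟨l, hl, x, rfl⟩
  obtain ⟨T, hT, hT'⟩ := exists_fixed_lift (Representation.linHom ρ τ) (Representation.linHom σ τ)
    (LinearMap.lcomp k Y i)
    (fun h T => by
      ext n
      simp [hiρ])
    p.ker (hp.of_equiv (QuotientGroup.quotientKerEquivRange p).toEquiv) T₀
    (fun l hl => by
      ext x
      simp only [Representation.linHom_apply, LinearMap.comp_apply]
      rw [hτ l hl, hT₀' _ (inv_mem hl)])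
    (fun h => by
      ext n
      simp only [Representation.linHom_apply, LinearMap.comp_apply, LinearMap.lcomp_apply, hT₀]
      rw [← hδ, Representation.self_inv_apply])
  refine ⟨T, fun n => (LinearMap.congr_fun hT n).trans (hT₀ n), fun h x => ?_⟩
  conv_lhs => rw [← hT' h]
  simp

end Averaging

/-! ### Left modules over a category -/

section Modules

variable {k : Type w} [CommRing k] {C : Type u} [Category.{v} C]

/-- The linear map `X(x) → X(y)` by which a morphism `f : x ⟶ y` acts on a left module `X`. -/
abbrev act (X : LeftModules k C) {x y : C} (f : x ⟶ y) : X.obj x →ₗ[k] X.obj y := (X.map f).hom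

theorem act_id (X : LeftModules k C) {x : C} (v : X.obj x) : act X (𝟙 x) v = v := by
  simp [act]

theorem act_comp (X : LeftModules k C) {x y z : C} (f : x ⟶ y) (g : y ⟶ z) (v : X.obj x) :
    act X (f ≫ g) v = act X g (act X f v) := by
  simp [act]

theorem app_act {X Y : LeftModules k C} (η : X ⟶ Y) {x y : C} (f : x ⟶ y) (v : X.obj x) :
    (η.app y).hom (act X f v) = act Y f ((η.app x).hom v) :=
  LinearMap.congr_fun (congrArg ModuleCat.Hom.hom (η.naturality f)) v

/-- A left module given by modules `V x` and linear maps between them. -/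
abbrev ofActions (V : C → Type (max u v w)) [∀ x, AddCommGroup (V x)] [∀ x, Module k (V x)]
    (a : ∀ {x y : C}, (x ⟶ y) → V x →ₗ[k] V y) (hid : ∀ x v, a (𝟙 x) v = v)
    (hcomp : ∀ {x y z : C} (f : x ⟶ y) (g : y ⟶ z) (v), a (f ≫ g) v = a g (a f v)) :
    LeftModules k C where
  obj x := ModuleCat.of k (V x)
  map f := ModuleCat.ofHom (a f)
  map_id x := by
    ext v
    exact hid x v
  map_comp f g := by
    ext v
    exact hcomp f g v

/-- A morphism of left modules given by linear maps commuting with the actions. -/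
abbrev homOf {X Y : LeftModules k C} (φ : ∀ x, X.obj x →ₗ[k] Y.obj x)
    (h : ∀ {x y : C} (f : x ⟶ y) (v : X.obj x), φ y (act X f v) = act Y f (φ x v)) : X ⟶ Y where
  app x := ModuleCat.ofHom (φ x)
  naturality x y f := by
    ext v
    exact h f v

theorem epi_of_surjective {X Y : LeftModules k C} (η : X ⟶ Y)
    (h : ∀ x, Function.Surjective (η.app x).hom) : Epi η :=
  (NatTrans.epi_iff_epi_app η).2 fun x => (ModuleCat.epi_iff_surjective _).2 (h x)

theorem mono_of_injective {X Y : LeftModules k C} (η : X ⟶ Y)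
    (h : ∀ x, Function.Injective (η.app x).hom) : Mono η :=
  (NatTrans.mono_iff_mono_app η).2 fun x => (ModuleCat.mono_iff_injective _).2 (h x)

theorem surjective_of_epi {X Y : LeftModules k C} (η : X ⟶ Y) [Epi η] (x : C) :
    Function.Surjective (η.app x).hom :=
  (ModuleCat.epi_iff_surjective _).1 ((NatTrans.epi_iff_epi_app η).1 inferInstance x)

theorem injective_of_mono {X Y : LeftModules k C} (η : X ⟶ Y) [Mono η] (x : C) :
    Function.Injective (η.app x).hom :=
  (ModuleCat.mono_iff_injective _).1 ((NatTrans.mono_iff_mono_app η).1 inferInstance x)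

theorem exists_lift {P A B : LeftModules k C} (hP : Projective P) (e : A ⟶ B)
    (he : ∀ x, Function.Surjective (e.app x).hom) (φ : P ⟶ B) :
    ∃ ψ : P ⟶ A, ∀ x v, (e.app x).hom ((ψ.app x).hom v) = (φ.app x).hom v := by
  have := epi_of_surjective e he
  refine ⟨Projective.factorThru φ e, fun x v => ?_⟩
  conv_rhs => rw [← Projective.factorThru_comp φ e]
  rfl

/-- The submodule of a left module `X` given by an invariant family of submodules of the `X(x)`. -/
abbrev submodule (X : LeftModules k C) (W : ∀ x, Submodule k (X.obj x))
    (hW : ∀ {x y : C} (f : x ⟶ y) (v : X.obj x), v ∈ W x → act X f v ∈ W y) : LeftModules k C :=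
  ofActions (fun x => W x) (fun f => (act X f).restrict fun v hv => hW f v hv)
    (fun _ v => Subtype.ext (act_id X v.1)) fun f g v => Subtype.ext (act_comp X f g v.1)

theorem IsHereditary.projective_submodule (h : IsHereditary (LeftModules k C))
    {X : LeftModules k C} (hX : Projective X) (W : ∀ x, Submodule k (X.obj x))
    (hW : ∀ {x y : C} (f : x ⟶ y) (v : X.obj x), v ∈ W x → act X f v ∈ W y) :
    Projective (submodule X W hW) :=
  h X _ (homOf (fun x => (W x).subtype) fun _ _ => rfl)
    (mono_of_injective _ fun x => (W x).subtype_injective) hX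

section Free

variable (k) {J : Type (max u v w)}

/-- The free left module `⨁ⱼ kC(aⱼ, -)` on generators at the objects `aⱼ`. -/
noncomputable abbrev freeModule (a : J → C) : LeftModules k C :=
  ofActions (fun x => (Σ j, (a j ⟶ x)) →₀ k)
    (fun f => Finsupp.lmapDomain k k fun p => ⟨p.1, p.2 ≫ f⟩)
    (fun x v => by
      simp only [Category.comp_id]
      exact Finsupp.mapDomain_id) fun f g v => by
      simp only [Finsupp.lmapDomain_apply, ← Finsupp.mapDomain_comp]
      congr 1
      funext p
      simp

variable {k}

theorem act_freeModule_single (a : J → C) {x y : C} (f : x ⟶ y) (j : J) (g : a j ⟶ x) (r : k) :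
    act (freeModule k a) f (Finsupp.single ⟨j, g⟩ r : (Σ j, (a j ⟶ x)) →₀ k) =
      (Finsupp.single ⟨j, g ≫ f⟩ r : (Σ j, (a j ⟶ y)) →₀ k) :=
  Finsupp.mapDomain_single

/-- The morphism from a free left module sending the generators to given elements. -/
noncomputable abbrev freeModuleHom (a : J → C) (X : LeftModules k C) (v : ∀ j, X.obj (a j)) :
    freeModule k a ⟶ X :=
  homOf (fun x => Finsupp.linearCombination k fun p => act X p.2 (v p.1)) fun {x y} f w => by
    have : Finsupp.linearCombination k (fun p : Σ j, (a j ⟶ y) => act X p.2 (v p.1)) ∘ₗ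
        Finsupp.lmapDomain k k (fun p : Σ j, (a j ⟶ x) => ⟨p.1, p.2 ≫ f⟩) =
        act X f ∘ₗ Finsupp.linearCombination k fun p => act X p.2 (v p.1) := by
      ext p
      simpa using act_comp X p.2 f (v p.1)
    exact LinearMap.congr_fun this w

theorem projective_freeModule (a : J → C) : Projective (freeModule k a) where
  factors {A B} φ e _ := by
    choose v hv using fun j => surjective_of_epi e (a j)
      ((φ.app (a j)).hom (Finsupp.single ⟨j, 𝟙 _⟩ 1 : (Σ i, (a i ⟶ a j)) →₀ k))
    refine ⟨freeModuleHom a A v, ?_⟩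
    ext x : 2
    refine ModuleCat.hom_ext (Finsupp.lhom_ext' fun p => LinearMap.ext_ring ?_)
    have h1 : ((freeModuleHom a A v).app x).hom
        (Finsupp.single p 1 : (Σ j, (a j ⟶ x)) →₀ k) = act A p.2 (v p.1) := by
      simp
    change (e.app x).hom (((freeModuleHom a A v).app x).hom
      (Finsupp.single p 1 : (Σ j, (a j ⟶ x)) →₀ k)) = (φ.app x).hom (Finsupp.single p 1)
    rw [h1, app_act, hv, ← app_act, act_freeModule_single, Category.id_comp]

end Free

end Modules

/-! ### EI categories -/

section EI

variable {C : Type u} [Category.{v} C]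

/-- An element of `G_x` seen as a morphism. -/
abbrev endHom {x : C} (g : End x) : x ⟶ x := g

theorem end_mul {x : C} (g h : End x) : g * h = endHom h ≫ endHom g := rfl

variable [IsEI C]

theorem isIso_of_nonempty {x y : C} (f : x ⟶ y) (g : y ⟶ x) : IsIso f := by
  have h₁ : IsIso (f ≫ g) := IsEI.isIso_of_end _
  have h₂ : IsIso (g ≫ f) := IsEI.isIso_of_end _
  have : Mono f := mono_of_mono f g
  have : IsSplitEpi f := ⟨⟨inv (g ≫ f) ≫ g, by simp⟩⟩
  exact isIso_of_mono_of_isSplitEpi f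

theorem isIso_left {x y z : C} (f : x ⟶ y) (g : y ⟶ z) [IsIso (f ≫ g)] : IsIso f :=
  isIso_of_nonempty f (g ≫ inv (f ≫ g))

theorem isIso_right {x y z : C} (f : x ⟶ y) (g : y ⟶ z) [IsIso (f ≫ g)] : IsIso g :=
  isIso_of_nonempty g (inv (f ≫ g) ≫ f)

theorem strictlyBelow_of_not_isIso {x y : C} (f : x ⟶ y) (hf : ¬ IsIso f) : StrictlyBelow x y :=
  ⟨⟨f⟩, fun ⟨e⟩ => hf (isIso_of_nonempty f e.inv)⟩

theorem end_inv_comp {x : C} (g : End x) : endHom g⁻¹ ≫ endHom g = 𝟙 x :=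
  mul_inv_cancel g

theorem end_comp_inv {x : C} (g : End x) : endHom g ≫ endHom g⁻¹ = 𝟙 x :=
  inv_mul_cancel g

instance isIso_end {x : C} (g : End x) : IsIso (endHom g) := IsEI.isIso_of_end _

/-- The left stabiliser `{h ∈ G_d | h ∘ i = i}` of a morphism `i : x ⟶ d`. -/
noncomputable def leftStabiliser {x d : C} (i : x ⟶ d) : Subgroup (End d) where
  carrier := {h | i ≫ endHom h = i}
  mul_mem' {g h} hg hh := by
    change i ≫ endHom h ≫ endHom g = i
    rw [← Category.assoc, hh, hg]
  one_mem' := Category.comp_id i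
  inv_mem' {g} hg := by
    change i ≫ endHom g⁻¹ = i
    nth_rw 1 [← show i ≫ endHom g = i from hg]
    rw [Category.assoc, end_comp_inv, Category.comp_id]

/-- The right stabiliser `{g ∈ G_c | f ∘ g = f}` of a morphism `f : c ⟶ d`, as a subgroup of the
opposite group. -/
noncomputable def rightStabiliser {c d : C} (f : c ⟶ d) : Subgroup (End c)ᵐᵒᵖ where
  carrier := {g | endHom g.unop ≫ f = f}
  mul_mem' {g h} hg hh := by
    change (endHom g.unop ≫ endHom h.unop) ≫ f = f
    rw [Category.assoc, hh, hg]
  one_mem' := Category.id_comp f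
  inv_mem' {g} hg := by
    change endHom (g.unop)⁻¹ ≫ f = f
    nth_rw 1 [← show endHom g.unop ≫ f = f from hg]
    rw [← Category.assoc, end_inv_comp, Category.id_comp]

variable {k : Type w} [CommRing k]

/-- The value of a left module at `c` as a representation of `G_c`. -/
noncomputable abbrev repAt (X : LeftModules k C) (c : C) : Representation k (End c) (X.obj c) where
  toFun g := act X (endHom g)
  map_one' := LinearMap.ext fun v => act_id X v
  map_mul' _ _ := LinearMap.ext fun v => act_comp X _ _ v

section Coinduction

variable {d : C} {A B : Type (max u v w)} [AddCommGroup A] [Module k A] [AddCommGroup B]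
  [Module k B]

/-- Equivariant functions `(x ⟶ d) → A` vanishing outside `S`. -/
def equivariantFunctions (α : Representation k (End d) A) (S : ∀ {x : C}, (x ⟶ d) → Prop) (x : C) :
    Submodule k ((x ⟶ d) → A) where
  carrier := {s | (∀ (i : x ⟶ d) (h : End d), s (i ≫ endHom h) = α h (s i)) ∧
    ∀ i, ¬ S i → s i = 0}
  add_mem' {s t} hs ht := ⟨fun i h => by simp [hs.1 i h, ht.1 i h],
    fun i hi => by simp [hs.2 i hi, ht.2 i hi]⟩
  zero_mem' := ⟨by simp, by simp⟩
  smul_mem' r s hs := ⟨fun i h => by simp [hs.1 i h], fun i hi => by simp [hs.2 i hi]⟩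

/-- The coinduction of a representation `A` of `G_d`, restricted to functions supported in a family
`S` of morphisms into `d`. For `S` the set of all morphisms this is right adjoint to evaluation at
`d`; for `S` the set of isomorphisms it is `A` placed at the isomorphism class of `d`, with all
non-invertible morphisms acting by zero. -/
abbrev coinduced (α : Representation k (End d) A) (S : ∀ {x : C}, (x ⟶ d) → Prop)
    (hS : ∀ {x y : C} (f : x ⟶ y) (i : y ⟶ d), S (f ≫ i) → S i) : LeftModules k C :=
  ofActions (fun x => equivariantFunctions α S x)
    (fun {x y} f => (LinearMap.funLeft k A fun i : y ⟶ d => f ≫ i).restrict fun s hs =>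
      ⟨fun i h => by
        simp only [LinearMap.funLeft_apply]
        rw [← Category.assoc]
        exact hs.1 (f ≫ i) h, fun i hi => hs.2 _ fun h => hi (hS f i h)⟩)
    (fun _ s => Subtype.ext <| funext fun i => by simp [LinearMap.funLeft_apply])
    fun f g s => Subtype.ext <| funext fun i => congrArg s.1 (Category.assoc f g i)

/-- Equivariant functions on `C(x, d)` lift along surjections of representations when the
stabilisers of the points where they do not vanish are `kˣ`-finite. -/
theorem exists_equivariant_function_lift (α : Representation k (End d) A)
    (β : Representation k (End d) B) (q : A →ₗ[k] B) (hq : Function.Surjective q)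
    (hqe : ∀ g a, q (α g a) = β g (q a)) {x : C} (s : (x ⟶ d) → B)
    (hs : ∀ (i : x ⟶ d) (h : End d), s (i ≫ endHom h) = β h (s i))
    (hfin : ∀ i, s i ≠ 0 → UnitFinite k (leftStabiliser i)) :
    ∃ t : (x ⟶ d) → A, (∀ (i : x ⟶ d) (h : End d), t (i ≫ endHom h) = α h (t i)) ∧
      (∀ i, q (t i) = s i) ∧ ∀ i, s i = 0 → t i = 0 := by
  have hinv : ∀ g a, α g⁻¹ (α g a) = a := fun g a => Representation.inv_self_apply α g a
  have hinv' : ∀ g b, β g⁻¹ (β g b) = b := fun g a => Representation.inv_self_apply β g a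
  obtain ⟨t, ht⟩ := exists_equivariant_choice (ι := x ⟶ d)
    (fun i j => {h : End d // i ≫ endHom h = j})
    (fun i => {a : A // q a = s i ∧ (s i = 0 → a = 0)})
    (fun {i j} h a => ⟨α h.1 a.1, by rw [hqe, a.2.1, ← hs, h.2], fun h0 => by
      rw [← h.2, hs] at h0
      rw [a.2.2 (by rw [← hinv' h.1 (s i), h0, map_zero]), map_zero]⟩)
    (fun i => ⟨1, Category.comp_id i⟩)
    (fun {i j} h => ⟨h.1⁻¹, by
      obtain ⟨h, rfl⟩ := h
      rw [Category.assoc, end_comp_inv, Category.comp_id]⟩)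
    (fun {i j l} g h => ⟨h.1 * g.1, by rw [end_mul, ← Category.assoc, g.2, h.2]⟩)
    (fun e a => Subtype.ext (hinv _ _))
    (fun e f a => Subtype.ext (LinearMap.congr_fun (map_mul α f.1 e.1) a.1))
    (fun i => by
      by_cases h0 : s i = 0
      · exact ⟨⟨0, by simp [h0], fun _ => rfl⟩, fun e => Subtype.ext (by simp)⟩
      · obtain ⟨a, ha⟩ := hq (s i)
        obtain ⟨a', ha', hfix⟩ := exists_fixed_lift (α.comp (leftStabiliser i).subtype)
          (β.comp (leftStabiliser i).subtype) q (fun h a => hqe _ _) ⊥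
          ((hfin i h0).of_equiv QuotientGroup.quotientBot.toEquiv) a
          (by
            rintro l hl
            rw [Subgroup.mem_bot.1 hl, map_one, Module.End.one_apply])
          (fun h => by
            rw [ha]
            change β h.1 (s i) = s i
            rw [← hs, h.2])
        exact ⟨⟨a', ha'.trans ha, fun h => absurd h h0⟩, fun e => Subtype.ext (hfix ⟨e.1, e.2⟩)⟩)
  exact ⟨fun i => (t i).1, fun i h => congrArg Subtype.val (ht i _ ⟨h, rfl⟩).symm,
    fun i => (t i).2.1, fun i => (t i).2.2⟩

/-- Lifting property of the value `P(d)` of a projective left module. It is the lifting property of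
`P` against the coinduced modules, which is available when the stabilisers of the morphisms in the
family `S` are `kˣ`-finite. -/
theorem exists_lift_at {P : LeftModules k C} (hP : Projective P)
    (S : ∀ {x : C}, (x ⟶ d) → Prop) (hS : ∀ {x y : C} (f : x ⟶ y) (i : y ⟶ d), S (f ≫ i) → S i)
    (hfin : ∀ (x : C) (i : x ⟶ d), S i → UnitFinite k (leftStabiliser i))
    (α : Representation k (End d) A) (β : Representation k (End d) B) (q : A →ₗ[k] B)
    (hq : Function.Surjective q) (hqe : ∀ g a, q (α g a) = β g (q a)) (φ : P.obj d →ₗ[k] B)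
    (hφ : ∀ (g : End d) p, φ (act P (endHom g) p) = β g (φ p))
    (hφS : ∀ (x : C) (i : x ⟶ d), ¬ S i → ∀ p, φ (act P i p) = 0) :
    ∃ ψ : P.obj d →ₗ[k] A, (∀ p, q (ψ p) = φ p) ∧
      (∀ (g : End d) p, ψ (act P (endHom g) p) = α g (ψ p)) ∧
      ∀ (x : C) (i : x ⟶ d), ¬ S i → ∀ p, ψ (act P i p) = 0 := by
  let e : coinduced α S hS ⟶ coinduced β S hS := homOf
    (fun x => (q.compLeft (x ⟶ d)).restrict fun s hs =>
      ⟨fun i h => by simp [hs.1 i h, hqe], fun i hi => by simp [hs.2 i hi]⟩) fun _ _ => rfl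
  have he : ∀ x, Function.Surjective (e.app x).hom := by
    rintro x ⟨s, hs⟩
    obtain ⟨t, ht, hqt, ht0⟩ := exists_equivariant_function_lift α β q hq hqe s hs.1
      fun i hi => hfin x i (by_contra fun h => hi (hs.2 i h))
    exact ⟨⟨t, ht, fun i hi => ht0 i (hs.2 i hi)⟩, Subtype.ext (funext hqt)⟩
  let Φ : P ⟶ coinduced β S hS := homOf
    (fun x => (LinearMap.pi fun i : x ⟶ d => φ ∘ₗ act P i).codRestrict _ fun p =>
      ⟨fun i h => by
        simp only [LinearMap.pi_apply, LinearMap.comp_apply]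
        rw [act_comp, hφ], fun i hi => hφS x i hi p⟩)
    fun f p => Subtype.ext <| funext fun i => congrArg φ (act_comp P f i p).symm
  obtain ⟨Ψ, hΨ⟩ := exists_lift hP e he Φ
  have key : ∀ (x : C) (i : x ⟶ d) (p : P.obj x),
      ((Ψ.app d).hom (act P i p)).1 (𝟙 d) = ((Ψ.app x).hom p).1 i := by
    intro x i p
    rw [app_act]
    change ((Ψ.app x).hom p).1 (i ≫ 𝟙 d) = _
    rw [Category.comp_id]
  refine ⟨LinearMap.proj (𝟙 d) ∘ₗ (equivariantFunctions α S d).subtype ∘ₗ (Ψ.app d).hom,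
    fun p => ?_, fun g p => ?_, fun x i hi p => ?_⟩
  · have := congrFun (congrArg Subtype.val (hΨ d p)) (𝟙 d)
    exact this.trans (congrArg φ (act_id P p))
  · refine (key d (endHom g) p).trans ?_
    have := ((Ψ.app d).hom p).2.1 (𝟙 d) g
    rwa [Category.id_comp] at this
  · exact (key x i p).trans (((Ψ.app x).hom p).2.2 i hi)

end Coinduction

end EI

/-! ### Projective representations -/

theorem IsHereditary.of_equivalence {A : Type*} [Category* A] {B : Type*} [Category* B]
    (e : A ≌ B) (h : IsHereditary A) : IsHereditary B := fun P Q i _ hP =>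
  (e.symm.map_projective_iff Q).1 <|
    h (e.inverse.obj P) (e.inverse.obj Q) (e.inverse.map i) inferInstance
      ((e.symm.map_projective_iff P).2 hP)

section Rep

universe t

variable {k : Type w} [CommRing k] {G : Type v} [Group G]
  {V A B : Type t} [AddCommGroup V] [Module k V]
  [AddCommGroup A] [Module k A] [AddCommGroup B] [Module k B]

theorem exists_rep_lift {ρ : Representation k G V} (h : Projective (Rep.of ρ))
    (α : Representation k G A) (β : Representation k G B) (q : A →ₗ[k] B)
    (hq : Function.Surjective q) (hqe : ∀ g a, q (α g a) = β g (q a)) (φ : V →ₗ[k] B)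
    (hφ : ∀ g a, φ (ρ g a) = β g (φ a)) :
    ∃ ψ : V →ₗ[k] A, (∀ v, q (ψ v) = φ v) ∧ ∀ g v, ψ (ρ g v) = α g (ψ v) := by
  let e : Rep.of α ⟶ Rep.of β := Rep.ofHom (q.intertwiningMap_of_isIntertwiningMap _ _ hqe)
  let f : Rep.of ρ ⟶ Rep.of β := Rep.ofHom (φ.intertwiningMap_of_isIntertwiningMap _ _ hφ)
  have : Epi e := (Rep.epi_iff_surjective e).2 hq
  refine ⟨(Projective.factorThru f e).hom.toLinearMap, fun v => ?_,
    fun g v => Rep.hom_comm_apply (Projective.factorThru f e) g v⟩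
  have h1 := congrArg (fun t : Rep.of ρ ⟶ Rep.of β => t.hom v) (Projective.factorThru_comp f e)
  exact h1

theorem projective_rep_of_lift {ρ : Representation k G V}
    (h : ∀ {A B : Type t} [AddCommGroup A] [Module k A] [AddCommGroup B] [Module k B]
      (α : Representation k G A) (β : Representation k G B) (q : A →ₗ[k] B) (φ : V →ₗ[k] B),
      Function.Surjective q → (∀ g a, q (α g a) = β g (q a)) → (∀ g a, φ (ρ g a) = β g (φ a)) →
      ∃ ψ : V →ₗ[k] A, (∀ v, q (ψ v) = φ v) ∧ ∀ g v, ψ (ρ g v) = α g (ψ v)) :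
    Projective (Rep.of ρ) where
  factors {A B} f e _ := by
    obtain ⟨ψ, hψ, hψe⟩ := h A.ρ B.ρ e.hom.toLinearMap f.hom.toLinearMap
      ((Rep.epi_iff_surjective e).1 inferInstance) (fun g a => Rep.hom_comm_apply e g a)
      (fun g a => Rep.hom_comm_apply f g a)
    refine ⟨Rep.ofHom (ψ.intertwiningMap_of_isIntertwiningMap _ _ hψe), ?_⟩
    ext v
    exact hψ v

end Rep

section

variable {k : Type w} [CommRing k] {C : Type u} [Category.{v} C] [IsEI C]
  {V W : Type (max u v w)} [AddCommGroup V] [Module k V] [AddCommGroup W] [Module k W]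

theorem IsHereditary.projective_rep {c : C} (h : IsHereditary (GroupRingModules k c))
    {ρ : Representation k (End c) V} (hρ : Projective (Rep.of ρ)) (σ : Representation k (End c) W)
    (i : W →ₗ[k] V) (hi : Function.Injective i) (hiσ : ∀ g w, i (σ g w) = ρ g (i w)) :
    Projective (Rep.of σ) := by
  refine IsHereditary.of_equivalence Rep.equivalenceModuleMonoidAlgebra.symm h (Rep.of ρ) _
    (Rep.ofHom (i.intertwiningMap_of_isIntertwiningMap _ _ hiσ)) ?_ hρ
  exact (Rep.mono_iff_injective _).2 hi

theorem isHereditary_groupRingModules {c : C}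
    (h : ∀ {V W : Type (max u v w)} [AddCommGroup V] [Module k V] [AddCommGroup W] [Module k W]
      (ρ : Representation k (End c) V) (σ : Representation k (End c) W) (i : W →ₗ[k] V),
      Projective (Rep.of ρ) → Function.Injective i → (∀ g w, i (σ g w) = ρ g (i w)) →
      Projective (Rep.of σ)) :
    IsHereditary (GroupRingModules k c) :=
  IsHereditary.of_equivalence Rep.equivalenceModuleMonoidAlgebra fun P Q i _ hP =>
    h P.ρ Q.ρ i.hom.toLinearMap hP ((Rep.mono_iff_injective i).1 inferInstance)
      fun g w => Rep.hom_comm_apply i g w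

end

/-! ### Hereditary module categories have hereditary group rings -/

section

variable {k : Type w} [CommRing k] {C : Type u} [Category.{v} C] [IsEI C]

theorem leftStabiliser_of_isIso {x d : C} (i : x ⟶ d) [IsIso i] :
    UnitFinite k (leftStabiliser i) := by
  have : Subsingleton (leftStabiliser i) := by
    have key : ∀ h : leftStabiliser i, h.1 = (1 : End d) := fun h =>
      (cancel_epi i).1 ((show i ≫ endHom h.1 = i from h.2).trans (Category.comp_id i).symm)
    exact ⟨fun a b => Subtype.ext ((key a).trans (key b).symm)⟩
  exact .of_subsingleton _

/-- A submodule `W` of a projective representation `V` of `G_c` embeds in `F(c)` for a free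
`C`-module `F` on generators at `c`. The `C`-submodule of `F` generated by `W` is projective, has
value `W` at `c` and vanishes at all objects properly below `c`, so the lifting property at `c`
applies to it. -/
theorem IsHereditary.groupRingModules (h : IsHereditary (LeftModules k C)) (c : C) :
    IsHereditary (GroupRingModules k c) := by
  refine isHereditary_groupRingModules fun {V W} _ _ _ _ ρ σ i hρ hi hiσ => ?_
  let F : LeftModules k C := freeModule k fun _ : V => c
  let ev : F.obj c →ₗ[k] V := Finsupp.linearCombination k fun p : Σ _ : V, (c ⟶ c) =>
    ρ (show End c from p.2) p.1
  have hev : ∀ (g : End c) p, ev (repAt F c g p) = ρ g (ev p) := by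
    intro g p
    have : ev ∘ₗ repAt F c g = ρ g ∘ₗ ev := by
      refine Finsupp.lhom_ext' fun p => LinearMap.ext_ring ?_
      change ev (act F (endHom g) (Finsupp.single p 1 : (Σ _ : V, (c ⟶ c)) →₀ k)) =
        ρ g (ev (Finsupp.single p 1 : (Σ _ : V, (c ⟶ c)) →₀ k))
      rw [act_freeModule_single]
      refine ((Finsupp.linearCombination_single k _ _).trans (one_smul k _)).trans (Eq.trans ?_
        (congrArg (ρ g) ((Finsupp.linearCombination_single k _ _).trans (one_smul k _)).symm))
      exact LinearMap.congr_fun (map_mul ρ g (show End c from p.2)) p.1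
    exact LinearMap.congr_fun this p
  have hevs : Function.Surjective ev := fun v =>
    ⟨(Finsupp.single ⟨v, 𝟙 c⟩ 1 : (Σ _ : V, (c ⟶ c)) →₀ k), by
      refine ((Finsupp.linearCombination_single k _ _).trans (one_smul k _)).trans ?_
      exact LinearMap.congr_fun (map_one ρ) v⟩
  obtain ⟨s, hs, hse⟩ := exists_rep_lift hρ (repAt F c) ρ ev hevs hev LinearMap.id fun _ _ => rfl
  let N : ∀ x, Submodule k (F.obj x) := fun x =>
    Submodule.span k {p | ∃ (f : c ⟶ x) (m : W), p = act F f (s (i m))}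
  have hN : ∀ {x y : C} (f : x ⟶ y) (v : F.obj x), v ∈ N x → act F f v ∈ N y := by
    intro x y f v hv
    induction hv using Submodule.span_induction with
    | mem v hv =>
      obtain ⟨g, m, rfl⟩ := hv
      exact Submodule.subset_span ⟨g ≫ f, m, (act_comp F g f _).symm⟩
    | zero => rw [map_zero]; exact zero_mem _
    | add v w _ _ hv hw => rw [map_add]; exact add_mem hv hw
    | smul r v _ hv => rw [map_smul]; exact Submodule.smul_mem _ _ hv
  have hP := h.projective_submodule (projective_freeModule fun _ : V => c) N hN
  have hevN : ∀ p ∈ N c, ev p ∈ LinearMap.range i := by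
    intro p hp
    induction hp using Submodule.span_induction with
    | mem v hv =>
      obtain ⟨g, m, rfl⟩ := hv
      exact ⟨σ (show End c from g) m, by
        rw [hiσ]
        exact ((hev g (s (i m))).trans (congrArg _ (hs (i m)))).symm⟩
    | zero => rw [map_zero]; exact zero_mem _
    | add v w _ _ hv hw => rw [map_add]; exact add_mem hv hw
    | smul r v _ hv => rw [map_smul]; exact Submodule.smul_mem _ _ hv
  let e := LinearEquiv.ofInjective i hi
  let r : N c →ₗ[k] W := e.symm.toLinearMap ∘ₗ ev.restrict hevN
  have hr : ∀ p, i (r p) = ev p.1 := fun p =>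
    congrArg Subtype.val (e.apply_symm_apply ⟨ev p.1, hevN _ p.2⟩)
  let s' : W →ₗ[k] N c := (s ∘ₗ i).codRestrict (N c) fun m =>
    Submodule.subset_span ⟨𝟙 c, m, (act_id F _).symm⟩
  have hrs : ∀ m, r (s' m) = m := fun m => hi ((hr _).trans (hs (i m)))
  refine projective_rep_of_lift fun {A B} _ _ _ _ α β q φ hq hqe hφ => ?_
  obtain ⟨ψ, hψ, hψe, -⟩ := exists_lift_at hP (d := c) (fun {x} i => IsIso i)
    (fun f i _ => isIso_right f i) (fun x i _ => leftStabiliser_of_isIso i) α β q hq hqe (φ ∘ₗ r)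
    (fun g p => by
      refine (congrArg φ (hi ?_)).trans (hφ g (r p))
      rw [hiσ, hr, hr]
      exact hev g p.1)
    (fun x i hni p => by
      have hbot : N x = ⊥ := by
        refine Submodule.span_eq_bot.2 ?_
        rintro _ ⟨f, m, rfl⟩
        exact absurd (isIso_of_nonempty i f) hni
      have : p = 0 := Subtype.ext ((Submodule.mem_bot k).1 (hbot ▸ p.2))
      rw [this, map_zero, map_zero])
  refine ⟨ψ ∘ₗ s', fun m => (hψ _).trans (congrArg φ (hrs m)), fun g m => ?_⟩
  refine Eq.trans (congrArg ψ (Subtype.ext ?_)) (hψe g (s' m))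
  change s (i (σ g m)) = act F (endHom g) (s (i m))
  rw [hiσ, hse]
  rfl

end

/-! ### Factorisations into unfactorisable morphisms -/

section Factorisation

variable {C : Type u} [Category.{v} C]

theorem Unfactorisable.comp_iso [IsEI C] {x y z : C} {f : x ⟶ y} (hf : Unfactorisable f)
    (g : y ⟶ z) [IsIso g] : Unfactorisable (f ≫ g) := by
  refine ⟨fun h => hf.1 (isIso_left f g), fun t a b hab => ?_⟩
  refine (hf.2 t a (b ≫ inv g) (by rw [← Category.assoc, hab]; simp)).imp_right fun h => ?_
  have : IsIso (b ≫ inv g) := h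
  exact isIso_left b (inv g)

theorem Unfactorisable.iso_comp [IsEI C] {x y z : C} {f : y ⟶ z} (hf : Unfactorisable f)
    (g : x ⟶ y) [IsIso g] : Unfactorisable (g ≫ f) := by
  refine ⟨fun h => hf.1 (isIso_right g f), fun t a b hab => ?_⟩
  refine (hf.2 t (inv g ≫ a) b (by rw [Category.assoc, hab]; simp)).imp_left fun h => ?_
  have : IsIso (inv g ≫ a) := h
  exact isIso_right (inv g) a

/-- Morphisms of the form `u₁ ≫ (u₂ ≫ (⋯ ≫ (uₙ ≫ h)))` with `uᵢ` unfactorisable and `h` invertible.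
In contrast to `Chain`, such a composition is built from its source. -/
inductive IsComposite : ∀ {x y : C}, (x ⟶ y) → Prop
  | iso {x y : C} (f : x ⟶ y) (hf : IsIso f) : IsComposite f
  | cons {x y z : C} (u : x ⟶ y) (f : y ⟶ z) (hu : Unfactorisable u) (hf : IsComposite f) :
      IsComposite (u ≫ f)

theorem FFP.exists_last (h : FFP C) {x y : C} (f : x ⟶ y) (hf : ¬ IsIso f) :
    ∃ (z : C) (g : x ⟶ z) (α : z ⟶ y), Unfactorisable α ∧ g ≫ α = f := by
  obtain ⟨p, hp, rfl⟩ := h x y f hf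
  cases p with
  | nil => exact absurd (inferInstanceAs (IsIso (𝟙 x))) hf
  | cons p α => exact ⟨_, p.comp, α, hp.2, rfl⟩

variable [IsEI C]

theorem IsComposite.snoc {x y z : C} {f : x ⟶ y} (hf : IsComposite f) (α : y ⟶ z)
    (hα : Unfactorisable α) : IsComposite (f ≫ α) := by
  induction hf with
  | iso f hf =>
    rw [← Category.comp_id (f ≫ α)]
    exact .cons _ _ (hα.iso_comp f) (.iso _ inferInstance)
  | cons u f hu _ ih =>
    rw [Category.assoc]
    exact .cons _ _ hu (ih α hα)

theorem Chain.isComposite {x y : C} (p : Chain x y) (hp : p.IsUnfactorisable) :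
    IsComposite p.comp := by
  induction p with
  | nil => exact .iso _ (inferInstanceAs (IsIso (𝟙 x)))
  | cons p α ih => exact (ih hp.1).snoc α hp.2

theorem FFP.isComposite (h : FFP C) {x y : C} (f : x ⟶ y) : IsComposite f := by
  by_cases hf : IsIso f
  · exact .iso f hf
  · obtain ⟨p, hp, rfl⟩ := h x y f hf
    exact p.isComposite hp

theorem FFP.exists_first (h : FFP C) {x y : C} (f : x ⟶ y) (hf : ¬ IsIso f) :
    ∃ (z : C) (u : x ⟶ z) (g : z ⟶ y), Unfactorisable u ∧ u ≫ g = f := by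
  cases h.isComposite f with
  | iso f h => exact absurd h hf
  | cons u g hu hg => exact ⟨_, u, g, hu, rfl⟩

theorem not_isIso_comp_cons {x y z : C} (p : Chain x y) (α : y ⟶ z)
    (h : (p.cons α).IsUnfactorisable) : ¬ IsIso (p.cons α).comp := fun hi =>
  have : IsIso (p.comp ≫ α) := hi
  h.2.1 (isIso_right p.comp α)

/-- A category has unique first factors if in any two factorisations of a morphism whose first
factors are unfactorisable, these first factors agree up to an isomorphism. -/
def UniqueFirstFactors (C : Type u) [Category.{v} C] : Prop :=
  ∀ {x y y' z : C} (u : x ⟶ y) (f : y ⟶ z) (u' : x ⟶ y') (f' : y' ⟶ z), Unfactorisable u →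
    Unfactorisable u' → u ≫ f = u' ≫ f' → ∃ h : y ≅ y', u ≫ h.hom = u' ∧ h.hom ≫ f' = f

theorem UniqueFirstFactors.last (hC : UniqueFirstFactors C) (hFFP : FFP C) {x y y' z : C}
    (f : x ⟶ y) (α : y ⟶ z) (f' : x ⟶ y') (α' : y' ⟶ z) (hα : Unfactorisable α)
    (hα' : Unfactorisable α') (h : f ≫ α = f' ≫ α') :
    ∃ e : y ≅ y', f ≫ e.hom = f' ∧ e.hom ≫ α' = α := by
  induction hFFP.isComposite f generalizing y' with
  | iso f hf =>
    have h1 := (hα.iso_comp f).2 _ f' α' h.symm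
    have : IsIso f' := h1.resolve_right hα'.1
    refine ⟨(asIso f).symm ≪≫ asIso f', by simp, ?_⟩
    simp [← h]
  | cons u g hu hg ih =>
    have hf' : ¬ IsIso f' := by
      intro hf'
      have h1 := (hα'.iso_comp f').2 _ u (g ≫ α) (by rw [← h, Category.assoc])
      rcases h1 with h1 | h1
      · exact hu.1 h1
      · exact hα.1 (isIso_right g α)
    obtain ⟨t, u', g', hu', rfl⟩ := hFFP.exists_first f' hf'
    obtain ⟨e₀, he₀, he₀'⟩ := hC u (g ≫ α) u' (g' ≫ α') hu hu'
      (by rw [← Category.assoc, h, Category.assoc])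
    obtain ⟨e, he, he'⟩ := ih α (e₀.hom ≫ g') α' hα hα' (by rw [← he₀', Category.assoc])
    exact ⟨e, by rw [Category.assoc, he, ← Category.assoc, he₀], he'⟩

theorem UniqueFirstFactors.ladder (hC : UniqueFirstFactors C) (hFFP : FFP C) {x y y' : C}
    (p : Chain x y) (p' : Chain x y') (hp : p.IsUnfactorisable) (hp' : p'.IsUnfactorisable)
    (j : y ≅ y') (h : p.comp ≫ j.hom = p'.comp) : Ladder p p' j := by
  induction p generalizing y' with
  | nil =>
    cases p' with
    | nil =>
      have : j = Iso.refl x := Iso.ext ((Category.id_comp _).symm.trans h)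
      rw [this]
      exact .nil
    | cons p' α' =>
      refine absurd ?_ (not_isIso_comp_cons p' α' hp')
      rw [← h]
      change IsIso (𝟙 x ≫ j.hom)
      infer_instance
  | @cons b z p α ih =>
    cases p' with
    | nil =>
      refine absurd ?_ (not_isIso_comp_cons p α hp)
      have : (p.cons α).comp = j.inv := by
        rw [← Category.comp_id (p.cons α).comp, ← j.hom_inv_id, ← Category.assoc, h]
        exact Category.id_comp _
      rw [this]
      infer_instance
    | cons p' α' =>
      obtain ⟨e, he, he'⟩ := hC.last hFFP p.comp (α ≫ j.hom) p'.comp α' (hp.2.comp_iso _) hp'.2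
        ((Category.assoc _ _ _).symm.trans h)
      exact .cons (ih p' hp.1 hp'.1 e he) _ _ _ he'.symm

theorem UniqueFirstFactors.ufp (hC : UniqueFirstFactors C) (hFFP : FFP C) : UFP C :=
  fun _ _ p p' hp hp' h => hC.ladder hFFP p p' hp hp' (Iso.refl _) ((Category.comp_id _).trans h)

end Factorisation

/-! ### Hereditary module categories have unique factorisation -/

section FirstFactor

variable {C : Type u} [Category.{v} C]

/-- Two factorisations `x ⟶ y ⟶ z` and `x ⟶ y' ⟶ z` whose first factors are unfactorisable are
equivalent if they differ by an isomorphism `y ≅ y'`. -/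
def factorisationSetoid (x z : C) :
    Setoid (Σ y : C, {u : x ⟶ y // Unfactorisable u} × (y ⟶ z)) where
  r p q := ∃ h : p.1 ≅ q.1, p.2.1.1 ≫ h.hom = q.2.1.1 ∧ h.hom ≫ q.2.2 = p.2.2
  iseqv := ⟨fun p => ⟨Iso.refl _, by simp, by simp⟩,
    fun {p q} ⟨h, h₁, h₂⟩ => ⟨h.symm, by simp [← h₁], by simp [← h₂]⟩,
    fun {p q r} ⟨h, h₁, h₂⟩ ⟨h', h₁', h₂'⟩ => ⟨h ≪≫ h', by simp [← h₁', ← h₁],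
      by simp [← h₂, ← h₂']⟩⟩

/-- Factorisations of morphisms `x ⟶ z` with unfactorisable first factor, up to isomorphism of the
intermediate object. -/
def FactorisationClass (x z : C) : Type (max u v) := Quotient (factorisationSetoid x z)

namespace FactorisationClass

/-- The class of the factorisation `u ≫ f`. -/
def mk {x y z : C} (u : x ⟶ y) (hu : Unfactorisable u) (f : y ⟶ z) : FactorisationClass x z :=
  Quotient.mk _ ⟨y, ⟨u, hu⟩, f⟩

theorem mk_eq_mk {x y y' z : C} {u : x ⟶ y} {hu : Unfactorisable u} {f : y ⟶ z} {u' : x ⟶ y'}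
    {hu' : Unfactorisable u'} {f' : y' ⟶ z} :
    mk u hu f = mk u' hu' f' ↔ ∃ h : y ≅ y', u ≫ h.hom = u' ∧ h.hom ≫ f' = f :=
  Quotient.eq (r := factorisationSetoid x z)

theorem exists_mk {x z : C} (q : FactorisationClass x z) :
    ∃ (y : C) (u : x ⟶ y) (hu : Unfactorisable u) (f : y ⟶ z), q = mk u hu f := by
  obtain ⟨⟨y, ⟨u, hu⟩, f⟩⟩ := q
  exact ⟨y, u, hu, f, rfl⟩

/-- The morphism which is factorised. -/
def comp {x z : C} : FactorisationClass x z → (x ⟶ z) :=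
  Quotient.lift (fun p => p.2.1.1 ≫ p.2.2) fun p q ⟨h, h₁, h₂⟩ => by simp [← h₁, ← h₂]

/-- Composition of the second factor with a morphism. -/
def postcomp {x z t : C} (g : z ⟶ t) : FactorisationClass x z → FactorisationClass x t :=
  Quotient.map (fun p => ⟨p.1, p.2.1, p.2.2 ≫ g⟩) fun p q ⟨h, h₁, h₂⟩ => ⟨h, h₁, by simp [← h₂]⟩

theorem mk_comp_eq [IsEI C] {x y y' z : C} (u : x ⟶ y) (hu : Unfactorisable u) (g : y ⟶ y')
    [IsIso g] (f : y' ⟶ z) : mk (u ≫ g) (hu.comp_iso g) f = mk u hu (g ≫ f) :=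
  (mk_eq_mk.2 ⟨asIso g, rfl, rfl⟩).symm

end FactorisationClass

theorem mapDomain_apply_of_unique {k : Type*} [AddCommMonoid k] {X Y : Type*} (f : X → Y)
    (a : X →₀ k) (x : X) (h : ∀ x', f x' = f x → a x' ≠ 0 → x' = x) :
    Finsupp.mapDomain f a (f x) = a x := by
  classical
  rw [Finsupp.mapDomain, Finsupp.sum_apply, Finsupp.sum, Finset.sum_eq_single x]
  · simp
  · intro x' hx' hne
    rw [Finsupp.single_apply, if_neg]
    exact fun h' => hne (h x' h' (Finsupp.mem_support_iff.1 hx'))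
  · intro hx
    rw [Finsupp.notMem_support_iff.1 hx]
    simp

variable {k : Type w} [CommRing k]

theorem mapDomain_mem_supported {X Y : Type*} {s : Set X} {t : Set Y} {f : X → Y}
    (hf : Set.MapsTo f s t) {v : X →₀ k} (hv : v ∈ Finsupp.supported k k s) :
    Finsupp.mapDomain f v ∈ Finsupp.supported k k t := by
  classical
  intro y hy
  obtain ⟨x, hx, rfl⟩ := Finset.mem_image.1 (Finsupp.mapDomain_support hy)
  exact hf (hv hx)

variable (k) in
/-- The free `k`-modules on the classes of factorisations of morphisms `x ⟶ z`, as a left module in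
`z`. -/
noncomputable abbrev factorisationModule (x : C) : LeftModules k C :=
  ofActions (fun z => FactorisationClass x z →₀ k)
    (fun g => Finsupp.lmapDomain k k (FactorisationClass.postcomp g))
    (fun z v => by
      have : FactorisationClass.postcomp (x := x) (𝟙 z) = id := by
        funext q
        obtain ⟨y, u, hu, f, rfl⟩ := q.exists_mk
        exact congrArg (FactorisationClass.mk u hu) (Category.comp_id f)
      rw [Finsupp.lmapDomain_apply, this, Finsupp.mapDomain_id]) fun {z t s} g h v => by
      have : FactorisationClass.postcomp (x := x) (g ≫ h) =
          FactorisationClass.postcomp h ∘ FactorisationClass.postcomp g := by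
        funext q
        obtain ⟨y, u, hu, f, rfl⟩ := q.exists_mk
        exact congrArg (FactorisationClass.mk u hu) (Category.assoc f g h).symm
      rw [Finsupp.lmapDomain_apply, this, Finsupp.mapDomain_comp]
      rfl

/-- The radical of `kC(x, -)`, spanned by the non-invertible morphisms, is projective. Hence the
surjection onto it from `factorisationModule k x` has a section. Comparing the values of the section
at `u ≫ f = u' ≫ f'` shows that the two factorisations are equivalent. -/
theorem IsHereditary.uniqueFirstFactors [IsEI C] [Nontrivial k]
    (h : IsHereditary (LeftModules k C)) (hFFP : FFP C) : UniqueFirstFactors C := by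
  classical
  intro x y y' z u f u' f' hu hu' huf
  let a : PUnit.{max u v w + 1} → C := fun _ => x
  let W : ∀ z, Submodule k ((freeModule k a).obj z) := fun z =>
    Finsupp.supported k k {p : Σ j, (a j ⟶ z) | ¬ IsIso p.2}
  have hW : ∀ {z t : C} (f : z ⟶ t) (v : (freeModule k a).obj z), v ∈ W z →
      act (freeModule k a) f v ∈ W t := by
    intro z t f v hv
    exact mapDomain_mem_supported (s := {p : Σ j, (a j ⟶ z) | ¬ IsIso p.2})
      (t := {p : Σ j, (a j ⟶ t) | ¬ IsIso p.2})
      (fun p hp hi => hp (@isIso_left C _ _ _ _ _ p.2 f hi)) hv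
  have hproj := h.projective_submodule (projective_freeModule a) W hW
  have hcomp : ∀ {z} (q : FactorisationClass x z), ¬ IsIso q.comp := by
    intro z q
    obtain ⟨y, u, hu, f, rfl⟩ := q.exists_mk
    exact fun hi => hu.1 (@isIso_left C _ _ _ _ _ u f hi)
  let c : ∀ z, FactorisationClass x z → Σ j, (a j ⟶ z) := fun z q => ⟨⟨⟩, q.comp⟩
  let e : factorisationModule k x ⟶ submodule _ W hW := homOf
    (fun z => (Finsupp.lmapDomain k k (c z)).codRestrict (W z) fun v =>
      mapDomain_mem_supported (s := Set.univ) (fun q _ => hcomp q) (by simp)) fun {z t} g v => by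
    refine Subtype.ext ?_
    change Finsupp.mapDomain (c t) (Finsupp.mapDomain _ v) =
      Finsupp.mapDomain _ (Finsupp.mapDomain (c z) v)
    rw [← Finsupp.mapDomain_comp, ← Finsupp.mapDomain_comp]
    congr 1
    funext q
    obtain ⟨y, u, hu, f, rfl⟩ := q.exists_mk
    exact congrArg (Sigma.mk PUnit.unit) (Category.assoc u f g).symm
  have he : ∀ z, Function.Surjective (e.app z).hom := by
    rintro z ⟨v, hv⟩
    suffices ∃ q : FactorisationClass x z →₀ k, Finsupp.mapDomain (c z) q = v by
      obtain ⟨q, hq⟩ := this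
      exact ⟨q, Subtype.ext hq⟩
    have hv' : v ∈ Submodule.span k ((fun p : Σ j, (a j ⟶ z) => Finsupp.single p (1 : k)) ''
        {p | ¬ IsIso p.2}) := by
      rw [← Finsupp.supported_eq_span_single]
      exact hv
    clear hv
    induction hv' using Submodule.span_induction with
    | mem v hv =>
      obtain ⟨⟨⟨⟩, f⟩, hf, rfl⟩ := hv
      obtain ⟨t, u, g, hu, rfl⟩ := hFFP.exists_first f hf
      exact ⟨Finsupp.single (.mk u hu g) 1, Finsupp.mapDomain_single⟩
    | zero => exact ⟨0, Finsupp.mapDomain_zero⟩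
    | add v w _ _ hv hw =>
      obtain ⟨p, rfl⟩ := hv
      obtain ⟨q, rfl⟩ := hw
      exact ⟨p + q, Finsupp.mapDomain_add⟩
    | smul r v _ hv =>
      obtain ⟨p, rfl⟩ := hv
      exact ⟨r • p, Finsupp.mapDomain_smul r p⟩
  obtain ⟨Ψ, hΨ⟩ := exists_lift hproj e he (𝟙 _)
  let r : ∀ {z} (f : x ⟶ z), ¬ IsIso f → W z := fun {z} f hf =>
    ⟨Finsupp.single ⟨⟨⟩, f⟩ 1, Finsupp.single_mem_supported k 1 hf⟩
  let σ : ∀ {z} (f : x ⟶ z), ¬ IsIso f → FactorisationClass x z →₀ k := fun {z} f hf =>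
    (Ψ.app z).hom (r f hf)
  have hσ : ∀ {z} (f : x ⟶ z) (hf : ¬ IsIso f),
      Finsupp.mapDomain (c z) (σ f hf) = Finsupp.single ⟨⟨⟩, f⟩ 1 := fun {z} f hf =>
    congrArg Subtype.val (hΨ z (r f hf))
  have hσc : ∀ {z t} (f : x ⟶ z) (hf : ¬ IsIso f) (g : z ⟶ t) (hfg : ¬ IsIso (f ≫ g)),
      Finsupp.mapDomain (FactorisationClass.postcomp g) (σ f hf) = σ (f ≫ g) hfg := by
    intro z t f hf g hfg
    refine Eq.trans (app_act Ψ g (r f hf)).symm (congrArg (Ψ.app t).hom (Subtype.ext ?_))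
    exact Finsupp.mapDomain_single
  -- A class with invertible second factor is the only factorisation of its composition, so the
  -- section property determines its coefficient in `σ v`.
  have hone : ∀ {b t} (v : x ⟶ b) (hv : ¬ IsIso v) (w : x ⟶ t) (hw : Unfactorisable w) (g : t ⟶ b)
      [IsIso g], σ v hv (.mk w hw g) = if v = w ≫ g then 1 else 0 := by
    intro b t v hv w hw g _
    rw [← mapDomain_apply_of_unique (c b) (σ v hv) (.mk w hw g), hσ v hv, Finsupp.single_apply]
    · simp only [c, Sigma.mk.injEq, heq_eq_eq, true_and]
      rfl
    · intro q hq _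
      obtain ⟨t', w', hw', g', rfl⟩ := q.exists_mk
      have hq' : w' ≫ g' = w ≫ g :=
        eq_of_heq (Sigma.mk.inj hq).2
      have : IsIso g' := ((hw.comp_iso g).2 _ _ _ hq').resolve_left hw'.1
      rw [← Category.comp_id g, ← Category.comp_id g', ← FactorisationClass.mk_comp_eq,
        ← FactorisationClass.mk_comp_eq]
      congr 1
  -- If `[w, g ≫ f] = [u, f]` then `g` is invertible because its ends are isomorphic, so only the
  -- class of `u ≫ 𝟙` contributes to the coefficient of `[u, f]` in `f σ(u)`.
  have hcoef : ∀ {y} (u : x ⟶ y) (hu : Unfactorisable u) (f : y ⟶ z) (hni : ¬ IsIso (u ≫ f)),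
      σ (u ≫ f) hni (.mk u hu f) = 1 := by
    intro y u hu f hni
    rw [← hσc u hu.1 f hni]
    have h1 := mapDomain_apply_of_unique (FactorisationClass.postcomp f) (σ u hu.1)
        (.mk u hu (𝟙 y)) <| by
      intro q hq hq0
      obtain ⟨b, w, hw, g, rfl⟩ := q.exists_mk
      obtain ⟨i, -, -⟩ := FactorisationClass.mk_eq_mk.1 hq
      have : IsIso g := isIso_of_nonempty g i.inv
      rw [hone u hu.1] at hq0
      have huw : u = w ≫ g := by_contra fun hne => hq0 (if_neg hne)
      subst huw
      rw [FactorisationClass.mk_comp_eq w hw g, Category.comp_id]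
    rw [hone u hu.1, if_pos (Category.comp_id u).symm] at h1
    rw [← h1]
    congr 1
    exact congrArg (FactorisationClass.mk u hu) (Category.id_comp f).symm
  have hex : ∀ {y y'} (u : x ⟶ y) (hu : Unfactorisable u) (f : y ⟶ z) (u' : x ⟶ y')
      (hu' : Unfactorisable u') (f' : y' ⟶ z), u ≫ f = u' ≫ f' →
      ∃ (b : C) (w : x ⟶ b) (hw : Unfactorisable w) (g : b ⟶ y'), σ u' hu'.1 (.mk w hw g) ≠ 0 ∧
        FactorisationClass.mk w hw (g ≫ f') = .mk u hu f := by
    intro y y' u hu f u' hu' f' huf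
    have hni : ¬ IsIso (u ≫ f) := fun hi => hu.1 (isIso_left u f)
    have h1 := hcoef u hu f hni
    simp only [huf] at h1
    rw [← hσc u' hu'.1 f' (huf ▸ hni)] at h1
    have h2 : FactorisationClass.mk u hu f ∈
        (Finsupp.mapDomain (FactorisationClass.postcomp f') (σ u' hu'.1)).support := by
      rw [Finsupp.mem_support_iff, h1]
      exact one_ne_zero
    obtain ⟨q, hq, hqq⟩ := Finset.mem_image.1 (Finsupp.mapDomain_support h2)
    obtain ⟨b, w, hw, g, rfl⟩ := q.exists_mk
    exact ⟨b, w, hw, g, Finsupp.mem_support_iff.1 hq, hqq⟩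
  obtain ⟨b, w, hw, g, hg, hgf⟩ := hex u hu f u' hu' f' huf
  obtain ⟨b', w', hw', g', -, hgf'⟩ := hex u' hu' f' u hu f huf.symm
  obtain ⟨i, -, -⟩ := FactorisationClass.mk_eq_mk.1 hgf
  obtain ⟨i', -, -⟩ := FactorisationClass.mk_eq_mk.1 hgf'
  have : IsIso g := isIso_of_nonempty g (i'.inv ≫ g' ≫ i.inv)
  rw [hone u' hu'.1] at hg
  have huw : u' = w ≫ g := by_contra fun hne => hg (if_neg hne)
  subst huw
  rw [← FactorisationClass.mk_comp_eq w hw g f'] at hgf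
  exact FactorisationClass.mk_eq_mk.1 hgf.symm

end FirstFactor

/-! ### Hereditary module categories and biset stabilisers -/

section Stabilisers

variable {k : Type w} [CommRing k] {C : Type u} [Category.{v} C] [IsEI C]

/-- Let `K` be generated by `g₁, …, gₙ` with `f ∘ gᵢ = f`. The submodule of `⨁ᵢ kC(c, -)` generated
by `v = (gᵢ - 1)ᵢ` is projective, so the surjection `kC(c, -) → ⟨v⟩` has a section; let `e ∈ kG_c`
be the image of `v`. Then `e v = v` says that `1 - e` is fixed by right multiplication with `K`, and
`f v = 0` gives `f e = 0`, so that `1 - e` has augmentation `1`. -/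
theorem IsHereditary.locallyUnitFinite_rightStabiliser [Nontrivial k]
    (h : IsHereditary (LeftModules k C)) {c d : C} (f : c ⟶ d) :
    LocallyUnitFinite k (rightStabiliser f) := by
  classical
  rintro K hK ⟨S, rfl⟩
  let J : Type (max u v w) := ULift.{max u w} {g : (End c)ᵐᵒᵖ // g ∈ S}
  let a : PUnit.{max u v w + 1} → C := fun _ => c
  let F : LeftModules k C := freeModule k fun _ : J => c
  let gen : J → (c ⟶ c) := fun j => endHom j.down.1.unop
  have hgen : ∀ j, gen j ≫ f = f := fun j => hK (Subgroup.subset_closure j.down.2)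
  let v : F.obj c := ∑ j : J, ((Finsupp.single ⟨j, gen j⟩ 1 : (Σ _ : J, (c ⟶ c)) →₀ k) -
    Finsupp.single ⟨j, 𝟙 c⟩ 1)
  have hact : ∀ {x} (p : c ⟶ x), act F p v =
      ∑ j : J, ((Finsupp.single ⟨j, gen j ≫ p⟩ 1 : (Σ _ : J, (c ⟶ x)) →₀ k) -
        Finsupp.single ⟨j, p⟩ 1) := by
    intro x p
    refine (map_sum (act F p) _ _).trans (Finset.sum_congr rfl fun j _ => ?_)
    refine (map_sub (act F p) _ _).trans ?_
    rw [act_freeModule_single, act_freeModule_single, Category.id_comp]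
  have hfv : act F f v = 0 := by
    rw [hact]
    refine Finset.sum_eq_zero fun j _ => ?_
    rw [hgen, sub_self]
  let π : freeModule k a ⟶ F := freeModuleHom a F fun _ => v
  let W : ∀ x, Submodule k (F.obj x) := fun x => LinearMap.range (π.app x).hom
  have hW : ∀ {x y : C} (g : x ⟶ y) (v : F.obj x), v ∈ W x → act F g v ∈ W y := by
    rintro x y g _ ⟨p, rfl⟩
    exact ⟨act _ g p, app_act π g p⟩
  let π' : freeModule k a ⟶ submodule F W hW := homOf (fun x => (π.app x).hom.rangeRestrict)
    fun g p => Subtype.ext (app_act π g p)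
  obtain ⟨Ψ, hΨ⟩ := exists_lift
    (h.projective_submodule (projective_freeModule fun _ : J => c) W hW) π'
    (fun x => LinearMap.surjective_rangeRestrict _) (𝟙 _)
  have hπ : ∀ (x : C) (p : Σ j, (a j ⟶ x)), (π.app x).hom (Finsupp.single p 1) = act F p.2 v :=
    fun x p => (Finsupp.linearCombination_single k _ _).trans (one_smul k _)
  let i : Σ j, (a j ⟶ c) := ⟨⟨⟩, 𝟙 c⟩
  have hvW : v ∈ W c := ⟨Finsupp.single i 1, (hπ c i).trans (act_id F v)⟩
  let e : (Σ j, (a j ⟶ c)) →₀ k := (Ψ.app c).hom ⟨v, hvW⟩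
  have he : (π.app c).hom e = v := congrArg Subtype.val (hΨ c ⟨v, hvW⟩)
  have hfe : act (freeModule k a) f e = 0 := by
    refine (app_act Ψ f ⟨v, hvW⟩).symm.trans ?_
    rw [← map_zero (Ψ.app d).hom]
    exact congrArg _ (Subtype.ext hfv)
  let b : (Σ j, (a j ⟶ c)) →₀ k := Finsupp.single i 1 - e
  have hπb : (π.app c).hom b = 0 :=
    (map_sub (π.app c).hom (Finsupp.single i 1 : (Σ j, (a j ⟶ c)) →₀ k) e).trans <| by
      rw [hπ c i, he]
      exact (congrArg (· - v) (act_id F v)).trans (sub_self v)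
  -- The `j`-th component of `b v` is `b gⱼ - b`.
  have hcomp : ∀ j, Finsupp.mapDomain (fun p : Σ j, (a j ⟶ c) => ⟨p.1, gen j ≫ p.2⟩) b = b := by
    intro j
    let pr : F.obj c →ₗ[k] (Σ j, (a j ⟶ c)) →₀ k :=
      Finsupp.linearCombination k fun q : Σ _ : J, (c ⟶ c) =>
        if q.1 = j then Finsupp.single ⟨⟨⟩, q.2⟩ 1 else 0
    have hpr : ∀ q : Σ _ : J, (c ⟶ c), pr (Finsupp.single q 1) =
        if q.1 = j then (Finsupp.single ⟨⟨⟩, q.2⟩ 1 : (Σ j, (a j ⟶ c)) →₀ k) else 0 := fun q =>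
      (Finsupp.linearCombination_single k _ _).trans (one_smul k _)
    have : pr ∘ₗ (π.app c).hom =
        Finsupp.lmapDomain k k (fun p : Σ j, (a j ⟶ c) => ⟨p.1, gen j ≫ p.2⟩) - LinearMap.id := by
      refine Finsupp.lhom_ext' fun p => LinearMap.ext_ring ?_
      change pr ((π.app c).hom (Finsupp.single p 1)) = Finsupp.mapDomain _ (Finsupp.single p 1) -
        Finsupp.single p 1
      rw [hπ, hact, Finsupp.mapDomain_single]
      refine (map_sum pr _ _).trans ?_
      rw [Finset.sum_eq_single j]
      · refine (map_sub pr _ _).trans ?_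
        rw [hpr, hpr, if_pos rfl, if_pos rfl]
      · intro j' _ hj'
        refine (map_sub pr _ _).trans ?_
        rw [hpr, hpr, if_neg hj', if_neg hj', sub_self]
      · exact fun hj => absurd (Finset.mem_univ j) hj
    have h1 := LinearMap.congr_fun this b
    have h2 : Finsupp.mapDomain (fun p : Σ j, (a j ⟶ c) => ⟨p.1, gen j ≫ p.2⟩) b - b = 0 :=
      h1.symm.trans ((congrArg pr hπb).trans (map_zero pr))
    exact sub_eq_zero.1 h2
  let m : (End c)ᵐᵒᵖ → (Σ j, (a j ⟶ c)) → Σ j, (a j ⟶ c) := fun g p => ⟨p.1, endHom g.unop ≫ p.2⟩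
  have hminj : ∀ g, Function.Injective (m g) := by
    rintro g ⟨⟨⟩, p⟩ ⟨⟨⟩, q⟩ hpq
    have h1 : endHom g.unop ≫ p = endHom g.unop ≫ q :=
      eq_of_heq (Sigma.mk.inj hpq).2
    rw [(cancel_epi (endHom g.unop)).1 h1]
  let T : Subgroup (End c)ᵐᵒᵖ :=
    { carrier := {g | ∀ p, b (m g p) = b p}
      mul_mem' := fun {g g'} hg hg' p => by
        rw [← hg' p, ← hg (m g' p)]
        exact congrArg (fun q => b ⟨p.1, q⟩) (Category.assoc (endHom g.unop) (endHom g'.unop) p.2)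
      one_mem' := fun p => congrArg (fun q => b ⟨p.1, q⟩) (Category.id_comp p.2)
      inv_mem' := fun {g} hg p => by
        rw [← hg]
        refine congrArg (fun q => b ⟨p.1, q⟩) ?_
        change endHom g.unop ≫ endHom g.unop⁻¹ ≫ p.2 = p.2
        rw [← Category.assoc, end_comp_inv]
        exact Category.id_comp p.2 }
  have hT : Subgroup.closure (S : Set (End c)ᵐᵒᵖ) ≤ T := by
    refine (Subgroup.closure_le _).2 fun g hg p => ?_
    conv_lhs => rw [← hcomp ⟨⟨g, hg⟩⟩]
    exact Finsupp.mapDomain_apply (hminj g) b p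
  let _ : MulAction (Subgroup.closure (S : Set (End c)ᵐᵒᵖ)) (Σ j, (a j ⟶ c)) :=
    { smul := fun g p => m g.1 p
      one_smul := fun p => congrArg (Sigma.mk p.1) (Category.id_comp p.2)
      mul_smul := fun g g' p => congrArg (Sigma.mk p.1)
        (Category.assoc (endHom g.1.unop) (endHom g'.1.unop) p.2) }
  refine UnitFinite.of_invariant_finsupp (X := Σ j, (a j ⟶ c)) ?_ b (fun g p => hT g.2 p) ?_
  · rintro g ⟨⟨⟩, p⟩ hgp
    have h1 : endHom g.1.unop ≫ p = p :=
      eq_of_heq (Sigma.mk.inj hgp).2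
    have : IsIso p := IsEI.isIso_of_end p
    have h2 : endHom g.1.unop = 𝟙 c :=
      (cancel_mono p).1 (h1.trans (Category.id_comp p).symm)
    exact Subtype.ext (MulOpposite.unop_injective h2)
  · let ε : ∀ x, ((Σ j, (a j ⟶ x)) →₀ k) →ₗ[k] k := fun x =>
      Finsupp.linearCombination k fun _ => (1 : k)
    have hε : ε c e = 0 := by
      have h1 : ε d ∘ₗ Finsupp.lmapDomain k k (fun p : Σ j, (a j ⟶ c) => ⟨p.1, p.2 ≫ f⟩) = ε c := by
        refine Finsupp.lhom_ext' fun p => LinearMap.ext_ring ?_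
        simp [ε]
      rw [← h1]
      exact (congrArg (ε d) hfe).trans (map_zero _)
    have h1 : b.sum (fun _ r => r) = ε c b := by
      simp [ε, Finsupp.linearCombination_apply]
    rw [h1, map_sub, hε, sub_zero]
    simp [ε]

/-- The permutation representation on the free module `k[X]` for a `G`-set `X`. -/
noncomputable def permutationRep (k : Type*) [CommRing k] (G X : Type*) [Group G] [MulAction G X] :
    Representation k G (X →₀ k) where
  toFun g := Finsupp.lmapDomain k k (g • ·)
  map_one' := by
    ext x
    simp
  map_mul' g h := by
    ext x
    simp [mul_smul]

theorem permutationRep_single {G X : Type*} [Group G] [MulAction G X] (g : G) (x : X) (r : k) :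
    permutationRep k G X g (Finsupp.single x r) = Finsupp.single (g • x) r :=
  Finsupp.mapDomain_single

theorem permutationRep_apply {G X : Type*} [Group G] [MulAction G X] (g : G) (x : X) (a : X →₀ k) :
    permutationRep k G X g a (g • x) = a x :=
  Finsupp.mapDomain_apply (MulAction.injective g) a x

/-- If the canonical map `kG → k[G / K]` takes a `K`-invariant element `e` to the trivial coset then
`K` is `kˣ`-finite: the coefficients of `e` on `K` are constant and have sum `1`. -/
theorem unitFinite_of_invariant_preimage [Nontrivial k] {G : Type*} [Group G] (K : Subgroup G)
    (e : ULift.{max u w} G →₀ k) (he : ∀ g ∈ K, permutationRep k G (ULift.{max u w} G) g e = e)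
    (he₁ : Finsupp.mapDomain (fun g : ULift.{max u w} G => ULift.up.{max u w} (g.down : G ⧸ K)) e =
      Finsupp.single ⟨((1 : G) : G ⧸ K)⟩ 1) : UnitFinite k K := by
  classical
  let b := e.filter fun g => (ULift.up.{max u w} (g.down : G ⧸ K)) = ⟨((1 : G) : G ⧸ K)⟩
  have hmem : ∀ g : ULift.{max u w} G,
      (ULift.up.{max u w} (g.down : G ⧸ K)) = ⟨((1 : G) : G ⧸ K)⟩ ↔ g.down ∈ K := by
    intro g
    rw [ULift.up_inj, eq_comm, QuotientGroup.eq, inv_one, one_mul]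
  refine UnitFinite.of_invariant_finsupp (X := ULift.{max u w} G) (fun g x hgx => ?_) b
    (fun g x => ?_) ?_
  · exact Subtype.ext (mul_eq_right.1 (congrArg ULift.down hgx))
  · have h1 : (g • x).down ∈ K ↔ x.down ∈ K := Subgroup.mul_mem_cancel_left K g.2
    have h2 : e (g • x) = e x := by
      conv_lhs => rw [← he g.1 g.2]
      exact permutationRep_apply g.1 x e
    simp only [b, Finsupp.filter_apply, hmem, h1, h2]
  · have h1 := DFunLike.congr_fun he₁ ⟨((1 : G) : G ⧸ K)⟩
    rw [Finsupp.single_eq_same] at h1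
    rw [← h1, Finsupp.mapDomain, Finsupp.sum_apply, Finsupp.sum, Finsupp.sum,
      Finsupp.support_filter, Finset.sum_filter]
    refine Finset.sum_congr rfl fun x _ => ?_
    rw [Finsupp.single_apply]
    split_ifs with hx
    · exact Finsupp.filter_apply_pos _ _ hx
    · rfl

/-- Let `N ⊆ kC(c, -)` consist of the elements which have augmentation zero at the objects
isomorphic to `c`. As `N` is projective, the map `N(d) → k[G_d / K]`, where `K` is the projection of
the stabiliser of `u`, which sends `h u g` to the coset of `h` and all other morphisms to zero,
lifts to `kG_d`. The image `e ∈ kG_d` of `u` is `K`-invariant because `u - u g = u (1 - g)` with `1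
- g ∈ N(c)`. -/
theorem IsHereditary.unitFinite_of_unfactorisable [Nontrivial k]
    (h : IsHereditary (LeftModules k C)) {c d : C} (u : c ⟶ d) (hu : Unfactorisable u) :
    UnitFinite k ((bisetStabiliser u).map (MonoidHom.fst (End d) (End c)ᵐᵒᵖ)) := by
  classical
  set K := (bisetStabiliser u).map (MonoidHom.fst (End d) (End c)ᵐᵒᵖ) with hKdef
  have hKmem : ∀ x : End d, x ∈ K ↔ ∃ g : End c, endHom g ≫ u ≫ endHom x = u := by
    intro x
    constructor
    · rintro ⟨⟨y, g⟩, hy, rfl⟩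
      exact ⟨g.unop, hy⟩
    · rintro ⟨g, hg⟩
      exact ⟨(x, .op g), hg, rfl⟩
  let a : PUnit.{max u v w + 1} → C := fun _ => c
  let ε : ∀ x, ((Σ j, (a j ⟶ x)) →₀ k) →ₗ[k] k := fun x =>
    Finsupp.linearCombination k fun _ => (1 : k)
  let W : ∀ x, Submodule k ((freeModule k a).obj x) := fun x =>
    ⨅ _ : ∃ f : c ⟶ x, IsIso f, LinearMap.ker (ε x)
  have hWmem : ∀ {x} (p : (Σ j, (a j ⟶ x)) →₀ k),
      p ∈ W x ↔ ((∃ f : c ⟶ x, IsIso f) → ε x p = 0) := by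
    intro x p
    refine (Submodule.mem_iInf _).trans ?_
    rfl
  have hW : ∀ {x y : C} (f : x ⟶ y) (v : (freeModule k a).obj x), v ∈ W x →
      act (freeModule k a) f v ∈ W y := by
    intro x y f v hv
    refine (hWmem _).2 fun ⟨j, _⟩ => ?_
    have h1 : ε y ∘ₗ Finsupp.lmapDomain k k (fun p : Σ j, (a j ⟶ x) => ⟨p.1, p.2 ≫ f⟩) = ε x := by
      refine Finsupp.lhom_ext' fun p => LinearMap.ext_ring ?_
      simp [ε]
    refine (LinearMap.congr_fun h1 v).trans ?_
    by_cases hx : Nonempty (c ⟶ x)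
    · obtain ⟨g⟩ := hx
      exact (hWmem _).1 hv ⟨g, isIso_of_nonempty g (f ≫ inv j)⟩
    · have : IsEmpty (Σ j, (a j ⟶ x)) := ⟨fun p => hx ⟨p.2⟩⟩
      have hv0 : v = 0 := Subsingleton.elim (α := (Σ j, (a j ⟶ x)) →₀ k) v 0
      rw [hv0, map_zero]
  have hproj := h.projective_submodule (projective_freeModule a) W hW
  let q : (ULift.{max u w} (End d) →₀ k) →ₗ[k] (ULift.{max u w} (End d ⧸ K) →₀ k) :=
    Finsupp.lmapDomain k k fun g => ⟨(g.down : End d ⧸ K)⟩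
  have hq : Function.Surjective q := by
    refine Finsupp.mapDomain_surjective ?_
    rintro ⟨⟨x⟩⟩
    exact ⟨⟨x⟩, rfl⟩
  let β := permutationRep k (End d) (ULift.{max u w} (End d ⧸ K))
  have hqe : ∀ g p, q (permutationRep k (End d) (ULift.{max u w} (End d)) g p) = β g (q p) := by
    intro g p
    have h1 : q ∘ₗ permutationRep k (End d) (ULift.{max u w} (End d)) g = β g ∘ₗ q := by
      refine Finsupp.lhom_ext' fun x => LinearMap.ext_ring ?_
      simp only [q, β, LinearMap.comp_apply, Finsupp.lsingle_apply, permutationRep_single,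
        Finsupp.lmapDomain_apply, Finsupp.mapDomain_single]
      rfl
    exact LinearMap.congr_fun h1 p
  let φ₀ : (c ⟶ d) → (ULift.{max u w} (End d ⧸ K) →₀ k) := fun f =>
    if hf : ∃ (x : End d) (g : End c), endHom g ≫ u ≫ endHom x = f then
      Finsupp.single ⟨(hf.choose : End d ⧸ K)⟩ 1 else 0
  have hφ₀ : ∀ (x : End d) (g : End c),
      φ₀ (endHom g ≫ u ≫ endHom x) = Finsupp.single ⟨(x : End d ⧸ K)⟩ 1 := by
    intro x g
    have hf : ∃ (x' : End d) (g' : End c), endHom g' ≫ u ≫ endHom x' = endHom g ≫ u ≫ endHom x :=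
      ⟨x, g, rfl⟩
    simp only [φ₀]
    rw [dif_pos hf]
    congr 2
    obtain ⟨g', hg'⟩ := hf.choose_spec
    generalize hf.choose = x' at hg' ⊢
    refine QuotientGroup.eq.2 ((hKmem _).2 ⟨g * g'⁻¹, ?_⟩)
    change (endHom g'⁻¹ ≫ endHom g) ≫ u ≫ endHom x ≫ endHom x'⁻¹ = u
    calc (endHom g'⁻¹ ≫ endHom g) ≫ u ≫ endHom x ≫ endHom x'⁻¹
        = endHom g'⁻¹ ≫ (endHom g ≫ u ≫ endHom x) ≫ endHom x'⁻¹ := by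
          simp only [Category.assoc]
      _ = (endHom g'⁻¹ ≫ endHom g') ≫ u ≫ endHom x' ≫ endHom x'⁻¹ := by
          rw [← hg']
          simp only [Category.assoc]
      _ = u := by rw [end_inv_comp, end_comp_inv, Category.comp_id, Category.id_comp]
  have hφ₀0 : ∀ f : c ⟶ d, (¬ ∃ (x : End d) (g : End c), endHom g ≫ u ≫ endHom x = f) → φ₀ f = 0 :=
    fun f hf => dif_neg hf
  have hφ₀l : ∀ (f : c ⟶ d) (g : End c), φ₀ (endHom g ≫ f) = φ₀ f := by
    intro f g
    by_cases hf : ∃ (x : End d) (g : End c), endHom g ≫ u ≫ endHom x = f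
    · obtain ⟨x, g', rfl⟩ := hf
      rw [hφ₀, ← hφ₀ x (g' * g), ← Category.assoc]
      rfl
    · rw [hφ₀0 f hf, hφ₀0]
      rintro ⟨x, g', hg'⟩
      refine hf ⟨x, g' * g⁻¹, ?_⟩
      change (endHom g⁻¹ ≫ endHom g') ≫ u ≫ endHom x = f
      rw [Category.assoc, hg', ← Category.assoc, end_inv_comp, Category.id_comp]
  have hφ₀r : ∀ (f : c ⟶ d) (x : End d), φ₀ (f ≫ endHom x) = β x (φ₀ f) := by
    intro f x
    by_cases hf : ∃ (x : End d) (g : End c), endHom g ≫ u ≫ endHom x = f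
    · obtain ⟨x', g', rfl⟩ := hf
      rw [hφ₀, permutationRep_single]
      have := hφ₀ (x * x') g'
      rw [end_mul] at this
      simp only [Category.assoc] at this ⊢
      exact this
    · rw [hφ₀0 f hf, hφ₀0, map_zero]
      rintro ⟨x', g', hg'⟩
      refine hf ⟨x⁻¹ * x', g', ?_⟩
      change endHom g' ≫ u ≫ endHom x' ≫ endHom x⁻¹ = f
      rw [← Category.assoc u, ← Category.assoc, hg', Category.assoc, end_comp_inv, Category.comp_id]
  let Φ : ((Σ j, (a j ⟶ d)) →₀ k) →ₗ[k] (ULift.{max u w} (End d ⧸ K) →₀ k) :=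
    Finsupp.linearCombination k fun p => φ₀ p.2
  have hΦ : ∀ {x} (f : x ⟶ d) (p : (Σ j, (a j ⟶ x)) →₀ k), Φ (act (freeModule k a) f p) =
      Finsupp.linearCombination k (fun p : Σ j, (a j ⟶ x) => φ₀ (p.2 ≫ f)) p := by
    intro x f p
    exact Finsupp.linearCombination_mapDomain k _ p
  obtain ⟨ψ, hψ, hψe, hψ0⟩ := exists_lift_at hproj (d := d) (fun {x} i => IsIso i)
    (fun f i _ => isIso_right f i) (fun x i _ => leftStabiliser_of_isIso i)
    (permutationRep k (End d) (ULift.{max u w} (End d))) β q hq hqe (Φ ∘ₗ (W d).subtype)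
    (fun g p => by
      refine (hΦ (endHom g) p.1).trans ?_
      simp only [hφ₀r]
      exact LinearMap.congr_fun (Finsupp.linearCombination_linear_comp k (β g)) p.1)
    (fun x i hi p => by
      refine (hΦ i p.1).trans ?_
      by_cases hx : ∃ f : c ⟶ x, IsIso f
      · obtain ⟨j, hj⟩ := hx
        have h1 : ∀ g : Σ j, (a j ⟶ x), φ₀ (g.2 ≫ i) = φ₀ (j ≫ i) := by
          intro g
          rw [← hφ₀l (j ≫ i) (show End c from g.2 ≫ inv j)]
          congr 1
          change _ = (g.2 ≫ inv j) ≫ j ≫ i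
          simp
        simp only [h1]
        have h2 : (Finsupp.linearCombination k fun _ : Σ j, (a j ⟶ x) => φ₀ (j ≫ i)) =
            (LinearMap.toSpanSingleton k _ (φ₀ (j ≫ i))) ∘ₗ ε x := by
          refine Finsupp.lhom_ext' fun p => LinearMap.ext_ring ?_
          simp [ε]
        rw [h2, LinearMap.comp_apply, (hWmem p.1).1 p.2 ⟨j, hj⟩, map_zero]
      · have h1 : ∀ g : Σ j, (a j ⟶ x), φ₀ (g.2 ≫ i) = 0 := by
          intro g
          refine hφ₀0 _ ?_
          rintro ⟨y, g', hg'⟩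
          have h2 : (endHom g'⁻¹ ≫ g.2) ≫ i ≫ endHom y⁻¹ = u := by
            calc (endHom g'⁻¹ ≫ g.2) ≫ i ≫ endHom y⁻¹ = endHom g'⁻¹ ≫ (g.2 ≫ i) ≫ endHom y⁻¹ := by
                  simp only [Category.assoc]
              _ = (endHom g'⁻¹ ≫ endHom g') ≫ u ≫ endHom y ≫ endHom y⁻¹ := by
                  rw [← hg']
                  simp only [Category.assoc]
              _ = u := by rw [end_inv_comp, end_comp_inv, Category.comp_id, Category.id_comp]
          rcases hu.2 _ _ _ h2 with h3 | h3
          · exact hx ⟨_, h3⟩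
          · exact hi (isIso_left i (endHom y⁻¹))
        simp only [h1]
        exact LinearMap.congr_fun (Finsupp.linearCombination_zero _ _ k) p.1)
  have hud : ∀ p : (Σ j, (a j ⟶ d)) →₀ k, p ∈ W d := fun p => (hWmem p).2 fun ⟨j, _⟩ =>
    absurd (isIso_of_nonempty u (inv j)) hu.1
  let s : (c ⟶ d) → W d := fun f => ⟨Finsupp.single ⟨⟨⟩, f⟩ 1, hud _⟩
  refine unitFinite_of_invariant_preimage K (ψ (s u)) (fun x hx => ?_) ?_
  · obtain ⟨g, hg⟩ := (hKmem x).1 hx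
    rw [← hψe]
    have h1 : u ≫ endHom x = endHom g⁻¹ ≫ u := by
      have h2 := congrArg (endHom g⁻¹ ≫ ·) hg
      simp only [← Category.assoc] at h2
      rwa [end_inv_comp, Category.id_comp] at h2
    let t : W c := ⟨Finsupp.single ⟨⟨⟩, endHom g⁻¹⟩ 1 - Finsupp.single ⟨⟨⟩, 𝟙 c⟩ 1,
      (hWmem _).2 fun _ => by simp [ε]⟩
    have h2 := hψ0 c u hu.1 t
    rw [← sub_eq_zero, ← map_sub, ← h2]
    refine congrArg ψ (Subtype.ext ?_)
    refine Eq.trans ?_ (map_sub (act (freeModule k a) u) _ _).symm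
    rw [act_freeModule_single, act_freeModule_single, Category.id_comp, ← h1]
    exact congrArg (· - _) (act_freeModule_single a (endHom x) PUnit.unit u 1)
  · refine (hψ (s u)).trans ?_
    refine (Finsupp.linearCombination_single k _ _).trans ((one_smul k _).trans ?_)
    have := hφ₀ 1 1
    rwa [show endHom (1 : End c) ≫ u ≫ endHom (1 : End d) = u from
      (Category.id_comp _).trans (Category.comp_id u)] at this

/-- If first factors are unique, the elements of `G_d` occurring in the stabiliser of `g ≫ α`, with
`α` unfactorisable, occur in the stabiliser of `α`. -/
theorem IsHereditary.conditionB [Nontrivial k] (h : IsHereditary (LeftModules k C))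
    (hFFP : FFP C) (hC : UniqueFirstFactors C) : ConditionB C k := by
  rintro c d ⟨-, hcd⟩ f
  have hf : ¬ IsIso f := fun _ => hcd ⟨asIso f⟩
  obtain ⟨z, g, α, hα, rfl⟩ := hFFP.exists_last f hf
  refine (h.unitFinite_of_unfactorisable α hα).of_le ?_
  rintro _ ⟨⟨x, y⟩, hxy, rfl⟩
  have hxy' : endHom y.unop ≫ (g ≫ α) ≫ endHom x = g ≫ α := hxy
  obtain ⟨e, -, he⟩ := hC.last hFFP (endHom y.unop ≫ g) (α ≫ endHom x) g α (hα.comp_iso _) hα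
    (by simpa only [Category.assoc] using hxy')
  refine ⟨(x, .op e.inv), ?_, rfl⟩
  change e.inv ≫ α ≫ endHom x = α
  rw [← he, Iso.inv_hom_id_assoc]

theorem IsHereditary.conditionA [Nontrivial k] (h : IsHereditary (LeftModules k C))
    (hB : ConditionB C k) : ConditionA C k := by
  intro c d hcd f K hK hKfg
  let p : K →* End d := (MonoidHom.fst (End d) (End c)ᵐᵒᵖ).comp K.subtype
  have hrange : UnitFinite k p.range := by
    refine (hB c d hcd f).of_le ?_
    rintro _ ⟨x, rfl⟩
    exact ⟨x.1, hK x.2, rfl⟩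
  refine .of_ker_range p ?_ hrange
  have := hrange.1
  have : Group.FG K := (Group.fg_iff_subgroup_fg K).2 hKfg
  have hfi : p.ker.FiniteIndex := by
    have : Finite (K ⧸ p.ker) :=
      Finite.of_equiv _ (QuotientGroup.quotientKerEquivRange p).symm.toEquiv
    exact Subgroup.finiteIndex_of_finite_quotient
  have hker : Group.FG p.ker := Subgroup.fg_of_index_ne_zero _
  let r : p.ker →* (End c)ᵐᵒᵖ :=
    (MonoidHom.snd (End d) (End c)ᵐᵒᵖ).comp (K.subtype.comp p.ker.subtype)
  have hr : Function.Injective r := fun x y hxy =>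
    Subtype.ext (Subtype.ext (Prod.ext (x.2.trans y.2.symm) hxy))
  refine UnitFinite.of_equiv (MonoidHom.ofInjective hr).toEquiv ?_
  refine h.locallyUnitFinite_rightStabiliser f r.range ?_ ?_
  · rintro _ ⟨x, rfl⟩
    have h1 : endHom x.1.1.2.unop ≫ f ≫ endHom x.1.1.1 = f := hK x.1.2
    have h2 : x.1.1.1 = (1 : End d) := x.2
    rw [h2] at h1
    change endHom x.1.1.2.unop ≫ f = f
    exact (congrArg (endHom x.1.1.2.unop ≫ ·) (Category.comp_id f)).symm.trans h1
  · exact (Group.fg_iff_subgroup_fg _).1 (Group.fg_range r)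

end Stabilisers

/-! ### Derivations from unique factorisation -/

section Derivation

variable {k : Type w} [CommRing k] {C : Type u} [Category.{v} C]

/-- The composition of a chain `α₁, …, αₙ` acts on extensions twisted by maps `T αᵢ : P → Y` through
`∑ᵢ αₙ ⋯ αᵢ₊₁ T(αᵢ) αᵢ₋₁ ⋯ α₁`. -/
def Chain.derivation {P Y : LeftModules k C} (T : ∀ {x y : C}, (x ⟶ y) → P.obj x →ₗ[k] Y.obj y)
    {x : C} : ∀ {y : C}, Chain x y → (P.obj x →ₗ[k] Y.obj y)
  | _, .nil => 0
  | _, .cons p α => act Y α ∘ₗ p.derivation T + T α ∘ₗ act P p.comp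

variable {P Y : LeftModules k C} {T : ∀ {x y : C}, (x ⟶ y) → P.obj x →ₗ[k] Y.obj y}

theorem Chain.derivation_nil {x : C} (v : P.obj x) :
    (Chain.nil : Chain x x).derivation T v = 0 := rfl

theorem Chain.derivation_cons {x y z : C} (p : Chain x y) (α : y ⟶ z) (v : P.obj x) :
    (p.cons α).derivation T v = act Y α (p.derivation T v) + T α (act P p.comp v) := rfl

theorem Ladder.derivation
    (hl : ∀ {x y z : C} (g : x ⟶ y) [IsIso g] (f : y ⟶ z) (v), Unfactorisable f →
      T (g ≫ f) v = T f (act P g v))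
    (hr : ∀ {x y z : C} (f : x ⟶ y) (g : y ⟶ z) [IsIso g] (v), Unfactorisable f →
      T (f ≫ g) v = act Y g (T f v))
    {x y y' : C} {p : Chain x y} {p' : Chain x y'} {h : y ≅ y'} (H : Ladder p p' h)
    (hp : p.IsUnfactorisable) (hp' : p'.IsUnfactorisable) :
    p'.comp = p.comp ≫ h.hom ∧ ∀ v, p'.derivation T v = act Y h.hom (p.derivation T v) := by
  induction H with
  | nil => exact ⟨(Category.id_comp _).symm, fun v => (act_id Y _).symm⟩
  | @cons _ _ _ _ p p' h hL α α' h' comm ih =>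
    obtain ⟨h1, h2⟩ := ih hp.1 hp'.1
    constructor
    · change p'.comp ≫ α' = (p.comp ≫ α) ≫ h'.hom
      rw [h1, Category.assoc, Category.assoc, comm]
    · intro v
      rw [Chain.derivation_cons, Chain.derivation_cons, h1, h2, act_comp, ← hl h.hom α' _ hp'.2,
        ← act_comp, ← comm, hr α h'.hom _ hp.2, act_comp, map_add]

theorem Chain.exists_append {x y z : C} (p : Chain x y) (q : Chain y z)
    (hp : p.IsUnfactorisable) (hq : q.IsUnfactorisable) :
    ∃ r : Chain x z, r.IsUnfactorisable ∧ r.comp = p.comp ≫ q.comp ∧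
      ∀ v, r.derivation T v =
        act Y q.comp (p.derivation T v) + q.derivation T (act P p.comp v) := by
  induction q with
  | nil =>
    refine ⟨p, hp, (Category.comp_id _).symm, fun v => ?_⟩
    rw [Chain.derivation_nil, add_zero]
    exact (act_id Y _).symm
  | cons q α ih =>
    obtain ⟨r, hr, hc, hD⟩ := ih hq.1
    refine ⟨r.cons α, ⟨hr, hq.2⟩, ?_, fun v => ?_⟩
    · change r.comp ≫ α = p.comp ≫ q.comp ≫ α
      rw [hc, Category.assoc]
    · rw [Chain.derivation_cons, Chain.derivation_cons, hD, hc, act_comp, map_add]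
      change _ = act Y (q.comp ≫ α) _ + _
      rw [act_comp, add_assoc]

variable [IsEI C]

theorem UFP.ladder (hUFP : UFP C) {x y y' : C} (p : Chain x y) (p' : Chain x y')
    (hp : p.IsUnfactorisable) (hp' : p'.IsUnfactorisable) (j : y ≅ y')
    (h : p.comp ≫ j.hom = p'.comp) : Ladder p p' j := by
  cases p with
  | nil =>
    cases p' with
    | nil =>
      have : j = Iso.refl x := Iso.ext ((Category.id_comp _).symm.trans h)
      rw [this]
      exact .nil
    | cons p' α' =>
      refine absurd ?_ (not_isIso_comp_cons p' α' hp')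
      rw [← h]
      change IsIso (𝟙 x ≫ j.hom)
      infer_instance
  | cons p α =>
    have h1 : (p.cons (α ≫ j.hom)).comp = p'.comp := (Category.assoc _ _ _).symm.trans h
    cases hUFP x y' (p.cons (α ≫ j.hom)) p' ⟨hp.1, hp.2.comp_iso _⟩ hp' h1 with
    | cons hl _ α' _ comm => exact .cons hl _ _ _ ((Category.comp_id _).symm.trans comm)

theorem Chain.exists_iso_comp
    (hl : ∀ {x y z : C} (g : x ⟶ y) [IsIso g] (f : y ⟶ z) (v), Unfactorisable f →
      T (g ≫ f) v = T f (act P g v))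
    {x y z : C} (h : x ≅ y) (q : Chain y z) (hq : q.IsUnfactorisable) :
    ∃ (z' : C) (q' : Chain x z') (j : z' ≅ z), q'.IsUnfactorisable ∧
      q'.comp ≫ j.hom = h.hom ≫ q.comp ∧
      ∀ v, act Y j.hom (q'.derivation T v) = q.derivation T (act P h.hom v) := by
  induction q with
  | nil =>
    refine ⟨x, .nil, h, trivial, (Category.id_comp _).trans (Category.comp_id _).symm, fun v => ?_⟩
    rw [Chain.derivation_nil, Chain.derivation_nil, map_zero]
  | cons q α ih =>
    obtain ⟨z', q', j, hq', hc, hD⟩ := ih hq.1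
    refine ⟨_, q'.cons (j.hom ≫ α), Iso.refl _, ⟨hq', hq.2.iso_comp _⟩, ?_, fun v => ?_⟩
    · change (q'.comp ≫ j.hom ≫ α) ≫ 𝟙 _ = h.hom ≫ q.comp ≫ α
      rw [Category.comp_id, ← Category.assoc, hc, Category.assoc]
    · refine (act_id Y _).trans ?_
      rw [Chain.derivation_cons, Chain.derivation_cons, act_comp, hD, hl _ _ _ hq.2, ← act_comp,
        hc, act_comp]

/-- By unique factorisation, maps `T α : P(x) → Y(y)` for the unfactorisable `α : x ⟶ y`, compatible
with isomorphisms on both sides, extend to a derivation which vanishes on isomorphisms. Every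
morphism is a chain of unfactorisable morphisms followed by an isomorphism; the derivation is read
off from such a presentation. -/
theorem exists_derivation (hFFP : FFP C) (hUFP : UFP C)
    (hl : ∀ {x y z : C} (g : x ⟶ y) [IsIso g] (f : y ⟶ z) (v), Unfactorisable f →
      T (g ≫ f) v = T f (act P g v))
    (hr : ∀ {x y z : C} (f : x ⟶ y) (g : y ⟶ z) [IsIso g] (v), Unfactorisable f →
      T (f ≫ g) v = act Y g (T f v)) :
    ∃ D : ∀ {x y : C}, (x ⟶ y) → P.obj x →ₗ[k] Y.obj y,
      (∀ {x y : C} (f : x ⟶ y) [IsIso f] (v), D f v = 0) ∧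
      (∀ {x y : C} (f : x ⟶ y) (v), Unfactorisable f → D f v = T f v) ∧
      ∀ {x y z : C} (f : x ⟶ y) (g : y ⟶ z) (v),
        D (f ≫ g) v = act Y g (D f v) + D g (act P f v) := by
  let R : ∀ {x z : C}, (x ⟶ z) → (P.obj x →ₗ[k] Y.obj z) → Prop := fun {x z} f S =>
    ∃ (y : C) (p : Chain x y) (h : y ≅ z), p.IsUnfactorisable ∧ p.comp ≫ h.hom = f ∧
      ∀ v, S v = act Y h.hom (p.derivation T v)
  have hiso : ∀ {x z : C} (f : x ⟶ z) [IsIso f], R f 0 := fun {x z} f _ =>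
    ⟨x, .nil, asIso f, trivial, Category.id_comp _, fun v => by
      rw [Chain.derivation_nil, map_zero, LinearMap.zero_apply]⟩
  have hex : ∀ {x z : C} (f : x ⟶ z), ∃ S, R f S := by
    intro x z f
    by_cases hf : IsIso f
    · exact ⟨0, hiso f⟩
    · obtain ⟨p, hp, rfl⟩ := hFFP x z f hf
      exact ⟨p.derivation T, z, p, Iso.refl z, hp, Category.comp_id _, fun v => (act_id Y _).symm⟩
  have huniq : ∀ {x z : C} (f : x ⟶ z) (S S'), R f S → R f S' → S = S' := by
    rintro x z _ S S' ⟨y, p, h, hp, rfl, hS⟩ ⟨y', p', h', hp', hf, hS'⟩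
    have hlad := hUFP.ladder p p' hp hp' (h ≪≫ h'.symm) (by
      rw [Iso.trans_hom, ← Category.assoc, ← hf, Category.assoc, Iso.symm_hom, Iso.hom_inv_id,
        Category.comp_id])
    ext v
    rw [hS, hS', (hlad.derivation hl hr hp hp').2, ← act_comp]
    congr 2
    simp
  choose D hD using fun (x z : C) (f : x ⟶ z) => hex f
  refine ⟨fun {x z} f => D x z f, fun {x y} f _ v => ?_, fun {x y} f v hf => ?_,
    fun {x y z} f g v => ?_⟩
  · exact LinearMap.congr_fun (huniq f _ _ (hD x y f) (hiso f)) v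
  · refine LinearMap.congr_fun (huniq f _ (T f) (hD x y f)
      ⟨y, Chain.nil.cons f, Iso.refl y, ⟨trivial, hf⟩, ?_, fun v => ?_⟩) v
    · exact (Category.comp_id _).trans (Category.id_comp f)
    · refine Eq.trans ?_ (act_id Y _).symm
      rw [Chain.derivation_cons, Chain.derivation_nil, map_zero, zero_add]
      exact congrArg (T f) (act_id P v).symm
  · obtain ⟨a, p, h, hp, hf, hS⟩ := hD x y f
    obtain ⟨b, q, j, hq, hg, hS'⟩ := hD y z g
    obtain ⟨b', q', j', hq', hc, hD'⟩ := Chain.exists_iso_comp (Y := Y) hl h q hq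
    obtain ⟨r, hr', hrc, hrD⟩ := Chain.exists_append (T := T) p q' hp hq'
    refine LinearMap.congr_fun (huniq (f ≫ g) _ (act Y g ∘ₗ D x y f + D y z g ∘ₗ act P f)
      (hD x z (f ≫ g)) ⟨b', r, j' ≪≫ j, hr', ?_, fun v => ?_⟩) v
    · rw [hrc, ← hf, ← hg, Iso.trans_hom, Category.assoc, ← Category.assoc q'.comp, hc]
      simp only [Category.assoc]
    · change act Y g (D x y f v) + D y z g (act P f v) = _
      rw [hrD, hS, hS', Iso.trans_hom, act_comp, map_add, map_add, hD', ← act_comp P p.comp, hf]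
      congr 1
      have hgj : h.hom ≫ g = (q'.comp ≫ j'.hom) ≫ j.hom := by rw [hc, ← hg, Category.assoc]
      rw [← act_comp Y h.hom, hgj, act_comp, act_comp]

end Derivation

/-! ### Sufficiency of the conditions -/

section Sufficiency

variable {k : Type w} [CommRing k] {C : Type u} [Category.{v} C] [IsEI C]

theorem ConditionB.unitFinite_leftStabiliser (hB : ConditionB C k) {x d : C} (i : x ⟶ d) :
    UnitFinite k (leftStabiliser i) := by
  by_cases hi : IsIso i
  · exact leftStabiliser_of_isIso i
  · refine (hB x d (strictlyBelow_of_not_isIso i hi) i).of_le ?_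
    intro h hh
    refine ⟨(h, 1), ?_, rfl⟩
    exact (Category.id_comp _).trans hh

theorem ConditionB.projective_repAt (hB : ConditionB C k) {P : LeftModules k C}
    (hP : Projective P) (c : C) : Projective (Rep.of (repAt P c)) :=
  projective_rep_of_lift fun α β q φ hq hqe hφ => by
    obtain ⟨ψ, hψ, hψe, -⟩ := exists_lift_at hP (d := c) (fun {x} _ => True) (fun _ _ _ => trivial)
      (fun x i _ => hB.unitFinite_leftStabiliser i) α β q hq hqe φ hφ
      (fun x i hi => absurd trivial hi)
    exact ⟨ψ, hψ, hψe⟩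

/-- Lifting along an epimorphism is possible compatibly with all isomorphisms of `C` if the values
at all objects are projective representations. -/
theorem exists_lift_commuting_with_isos {Q X X' : LeftModules k C}
    (hQ : ∀ c, Projective (Rep.of (repAt Q c))) (e : X ⟶ X')
    (he : ∀ x, Function.Surjective (e.app x).hom) (φ : Q ⟶ X') :
    ∃ l : ∀ x, Q.obj x →ₗ[k] X.obj x, (∀ x v, (e.app x).hom (l x v) = (φ.app x).hom v) ∧
      ∀ {x y : C} (f : x ⟶ y) [IsIso f] (v), l y (act Q f v) = act X f (l x v) := by
  obtain ⟨l, hl⟩ := exists_equivariant_choice (ι := C) (fun x y => x ≅ y)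
    (fun x => {l : Q.obj x →ₗ[k] X.obj x // ∀ v, (e.app x).hom (l v) = (φ.app x).hom v})
    (fun {x y} j l => ⟨act X j.hom ∘ₗ l.1 ∘ₗ act Q j.inv, fun v => by
      simp only [LinearMap.comp_apply]
      rw [app_act, l.2, ← app_act, ← act_comp, Iso.inv_hom_id, act_id]⟩)
    Iso.refl (fun j => j.symm) (fun i j => i ≪≫ j)
    (fun j l => Subtype.ext <| LinearMap.ext fun v => by
      simp only [LinearMap.comp_apply, Iso.symm_hom, Iso.symm_inv]
      rw [← act_comp, ← act_comp, Iso.hom_inv_id, act_id, act_id])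
    (fun i j l => Subtype.ext <| LinearMap.ext fun v => by
      simp only [LinearMap.comp_apply, Iso.trans_hom, Iso.trans_inv]
      rw [act_comp, act_comp])
    (fun c => by
      obtain ⟨l, hl, hle⟩ := exists_rep_lift (hQ c) (repAt X c) (repAt X' c) (e.app c).hom (he c)
        (fun g v => app_act e (endHom g) v) (φ.app c).hom fun g v => app_act φ (endHom g) v
      refine ⟨⟨l, hl⟩, fun j => Subtype.ext <| LinearMap.ext fun v => ?_⟩
      simp only [LinearMap.comp_apply]
      have h1 : l (act Q j.inv v) = act X j.inv (l v) := hle (show End c from j.inv) v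
      rw [h1, ← act_comp, Iso.inv_hom_id, act_id])
  refine ⟨fun x => (l x).1, fun x => (l x).2, fun {x y} f _ v => ?_⟩
  have h1 := LinearMap.congr_fun (congrArg Subtype.val (hl x y (asIso f))) (act Q f v)
  refine h1.symm.trans ?_
  simp only [LinearMap.comp_apply]
  rw [← act_comp, asIso_hom, asIso_inv, IsIso.hom_inv_id, act_id]

/-- The maps `δ u : Q(x) → Y(y)`, compatible with isomorphisms, extend to maps `P(x) → Y(y)`
compatible with isomorphisms, for all non-invertible `u : x ⟶ y`. For a single `u` this is
`exists_equivariant_extension` for the stabiliser of `u`. -/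
theorem exists_extension_commuting_with_isos [IsSemisimpleRing k] (hA : ConditionA C k)
    (hB : ConditionB C k) {P Q Y : LeftModules k C} (i : Q ⟶ P)
    (hi : ∀ x, Function.Injective (i.app x).hom)
    (δ : ∀ {x y : C}, (x ⟶ y) → Q.obj x →ₗ[k] Y.obj y)
    (hδ : ∀ {x y z t : C} (f : x ⟶ y) [IsIso f] (u : y ⟶ z) (g : z ⟶ t) [IsIso g] (v),
      δ (f ≫ u ≫ g) v = act Y g (δ u (act Q f v))) :
    ∃ T : ∀ {x y : C}, (x ⟶ y) → P.obj x →ₗ[k] Y.obj y,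
      (∀ {x y : C} (u : x ⟶ y), ¬ IsIso u → ∀ v, T u ((i.app x).hom v) = δ u v) ∧
      ∀ {x y z t : C} (f : x ⟶ y) [IsIso f] (u : y ⟶ z) (g : z ⟶ t) [IsIso g], ¬ IsIso u →
        ∀ p, T (f ≫ u ≫ g) p = act Y g (T u (act P f p)) := by
  classical
  let ι := Σ x y : C, {u : x ⟶ y // ¬ IsIso u}
  obtain ⟨T, hT⟩ := exists_equivariant_choice (ι := ι)
    (fun a b => {j : (a.1 ≅ b.1) × (a.2.1 ≅ b.2.1) // j.1.inv ≫ a.2.2.1 ≫ j.2.hom = b.2.2.1})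
    (fun a => {T : P.obj a.1 →ₗ[k] Y.obj a.2.1 // ∀ v, T ((i.app a.1).hom v) = δ a.2.2.1 v})
    (fun {a b} j T => ⟨act Y j.1.2.hom ∘ₗ T.1 ∘ₗ act P j.1.1.inv, fun v => by
      simp only [LinearMap.comp_apply]
      rw [← app_act, T.2, ← hδ, j.2]⟩)
    (fun a => ⟨(Iso.refl _, Iso.refl _), by simp⟩)
    (fun {a b} j => ⟨(j.1.1.symm, j.1.2.symm), by simp [← j.2]⟩)
    (fun {a b c} j j' => ⟨(j.1.1 ≪≫ j'.1.1, j.1.2 ≪≫ j'.1.2), by simp [← j.2, ← j'.2]⟩)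
    (fun j T => Subtype.ext <| LinearMap.ext fun v => by
      simp only [LinearMap.comp_apply, Iso.symm_hom, Iso.symm_inv]
      rw [← act_comp, ← act_comp, Iso.hom_inv_id, Iso.hom_inv_id, act_id, act_id])
    (fun j j' T => Subtype.ext <| LinearMap.ext fun v => by
      simp only [LinearMap.comp_apply, Iso.trans_hom, Iso.trans_inv]
      rw [act_comp, act_comp])
    (fun ⟨x, y, u, hu⟩ => by
      let H := bisetStabiliser u
      let p : H →* End y := (MonoidHom.fst (End y) (End x)ᵐᵒᵖ).comp H.subtype
      let r : H →* End x := (MulEquiv.inv' (End x)).symm.toMonoidHom.comp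
        ((MonoidHom.snd (End y) (End x)ᵐᵒᵖ).comp H.subtype)
      have hru : ∀ a : H, endHom (r a) ≫ u = u ≫ endHom (p a) := by
        intro a
        have h1 : endHom a.1.2.unop ≫ u ≫ endHom a.1.1 = u := a.2
        have h2 := congrArg (endHom (a.1.2.unop)⁻¹ ≫ ·) h1
        rw [← Category.assoc, end_inv_comp, Category.id_comp] at h2
        exact h2.symm
      have hxy := strictlyBelow_of_not_isIso u hu
      obtain ⟨T, hT, hTe⟩ := exists_equivariant_extension p
        (fun K hK => by
          refine UnitFinite.of_equiv
            (K.equivMapOfInjective H.subtype H.subtype_injective).toEquiv ?_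
          refine hA x y hxy u _ ?_ ((Subgroup.fg_iff_submonoid_fg _).2
            (((Subgroup.fg_iff_submonoid_fg K).1 hK).map H.subtype))
          rintro _ ⟨a, _, rfl⟩
          exact a.2)
        ((hB x y hxy u).of_le (by
          rintro _ ⟨a, rfl⟩
          exact ⟨a.1, a.2, rfl⟩))
        ((repAt P x).comp r) ((repAt Q x).comp r) ((repAt Y y).comp p)
        (fun l hl v => by
          have h1 : p l = 1 := hl
          rw [MonoidHom.comp_apply, h1, map_one, Module.End.one_apply])
        (i.app x).hom (hi x) (fun a n => app_act i (endHom (r a)) n) (δ u)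
        (fun a n => by
          change δ u (act Q (endHom (r a)) n) = act Y (endHom (p a)) (δ u n)
          have h1 := hδ (endHom (r a)) u (𝟙 y) n
          have h2 := hδ (𝟙 x) u (endHom (p a)) n
          rw [act_id] at h1 h2
          rw [← h1, ← h2, Category.comp_id, Category.id_comp, hru])
      refine ⟨⟨T, hT⟩, fun ⟨⟨j₁, j₂⟩, hj⟩ => Subtype.ext <| LinearMap.ext fun v => ?_⟩
      change act Y j₂.hom (T (act P j₁.inv v)) = T v
      let a : H := ⟨(show End y from j₂.hom, .op (show End x from j₁.inv)), hj⟩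
      have h1 : T (act P j₁.hom (act P j₁.inv v)) = act Y j₂.hom (T (act P j₁.inv v)) := by
        refine Eq.trans ?_ (hTe a (act P j₁.inv v))
        congr 2
        have h2 : endHom (r a) = j₁.hom := by
          change endHom (show End x from j₁.inv)⁻¹ = j₁.hom
          rw [← cancel_mono j₁.inv, Iso.hom_inv_id]
          exact end_inv_comp (show End x from j₁.inv)
        exact congrArg (fun f => act P f) h2.symm
      rw [← h1, ← act_comp, Iso.inv_hom_id, act_id])
  refine ⟨fun {x y} u => if hu : IsIso u then 0 else (T ⟨x, y, u, hu⟩).1, fun {x y} u hu v => ?_,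
    fun {x y z t} f _ u g _ hu p => ?_⟩
  · simp only
    rw [dif_neg hu]
    exact (T ⟨x, y, u, hu⟩).2 v
  · have hu' : ¬ IsIso (f ≫ u ≫ g) := fun h1 =>
      have : IsIso (u ≫ g) := isIso_right f (u ≫ g)
      hu (isIso_left u g)
    simp only
    rw [dif_neg hu, dif_neg hu']
    have h1 := hT ⟨y, z, u, hu⟩ ⟨x, t, f ≫ u ≫ g, hu'⟩ ⟨((asIso f).symm, asIso g), rfl⟩
    exact (LinearMap.congr_fun (congrArg Subtype.val h1) p).symm

/-- A twisting `T` on unfactorisable morphisms defines an extension of `P` by `Y`, with underlying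
modules `P(x) × Y(x)` and `α` acting by `(p, y) ↦ (α p, α y + T α p)`. It splits when `P` is
projective, so that `T` is a coboundary. -/
theorem exists_coboundary (hFFP : FFP C) (hUFP : UFP C) {P Y : LeftModules k C}
    (hP : Projective P) (T : ∀ {x y : C}, (x ⟶ y) → P.obj x →ₗ[k] Y.obj y)
    (hl : ∀ {x y z : C} (g : x ⟶ y) [IsIso g] (f : y ⟶ z) (v), Unfactorisable f →
      T (g ≫ f) v = T f (act P g v))
    (hr : ∀ {x y z : C} (f : x ⟶ y) (g : y ⟶ z) [IsIso g] (v), Unfactorisable f →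
      T (f ≫ g) v = act Y g (T f v)) :
    ∃ m : ∀ x, P.obj x →ₗ[k] Y.obj x,
      (∀ {x y : C} (f : x ⟶ y) [IsIso f] (p), m y (act P f p) = act Y f (m x p)) ∧
      ∀ {x y : C} (f : x ⟶ y) (p), Unfactorisable f →
        m y (act P f p) = act Y f (m x p) + T f p := by
  obtain ⟨D, hiso, hunf, hcomp⟩ := exists_derivation hFFP hUFP hl hr
  let Z : LeftModules k C := ofActions (fun x => P.obj x × Y.obj x)
    (fun {x y} f => (act P f ∘ₗ LinearMap.fst k _ _).prod
      (act Y f ∘ₗ LinearMap.snd k _ _ + D f ∘ₗ LinearMap.fst k _ _))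
    (fun x v => Prod.ext (act_id P v.1) (by
      change act Y (𝟙 x) v.2 + D (𝟙 x) v.1 = v.2
      rw [act_id, hiso, add_zero]))
    (fun f g v => Prod.ext (act_comp P f g v.1) (by
      change act Y (f ≫ g) v.2 + D (f ≫ g) v.1 =
        act Y g (act Y f v.2 + D f v.1) + D g (act P f v.1)
      rw [act_comp, hcomp, map_add, add_assoc]))
  let pr : Z ⟶ P := homOf (fun x => LinearMap.fst k _ _) fun _ _ => rfl
  obtain ⟨s, hs⟩ := exists_lift hP pr (fun x => Prod.fst_surjective) (𝟙 P)
  have hs₁ : ∀ x p, ((s.app x).hom p).1 = p := hs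
  have key : ∀ {x y : C} (f : x ⟶ y) (p : P.obj x),
      ((s.app y).hom (act P f p)).2 = act Y f ((s.app x).hom p).2 + D f p := by
    intro x y f p
    rw [app_act]
    change act Y f ((s.app x).hom p).2 + D f ((s.app x).hom p).1 = _
    rw [hs₁]
  refine ⟨fun x => LinearMap.snd k _ _ ∘ₗ (s.app x).hom, fun f _ p => ?_, fun f p hf => ?_⟩
  · refine (key f p).trans ?_
    rw [hiso, add_zero]
    rfl
  · refine (key f p).trans ?_
    rw [hunf f p hf]
    rfl

/-- A submodule `Q` of a projective module `P` is projective. A morphism `φ : Q → X'` has lifts `l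
x` along `e : X → X'` which commute with isomorphisms. Their failure `δ u = u l - l u` to commute
with the unfactorisable `u` takes values in the kernel `Y` of `e`, extends to `P`, and is a
coboundary there; this coboundary corrects the lifts. -/
theorem isHereditary_of_conditions [IsSemisimpleRing k] (hFFP : FFP C)
    (hG : ∀ c : C, IsHereditary (GroupRingModules k c)) (hUFP : UFP C) (hA : ConditionA C k)
    (hB : ConditionB C k) : IsHereditary (LeftModules k C) := by
  intro P Q i _ hP
  have hi := fun x => injective_of_mono i x
  have hQ : ∀ c, Projective (Rep.of (repAt Q c)) := fun c =>
    (hG c).projective_rep (hB.projective_repAt hP c) (repAt Q c) (i.app c).hom (hi c)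
      fun g w => app_act i (endHom g) w
  refine ⟨fun {X X'} φ e _ => ?_⟩
  obtain ⟨l, hl, hliso⟩ := exists_lift_commuting_with_isos hQ e (surjective_of_epi e) φ
  let Y : LeftModules k C := submodule X (fun x => LinearMap.ker (e.app x).hom) fun f v hv => by
    rw [LinearMap.mem_ker] at hv ⊢
    rw [app_act, hv, map_zero]
  let δ : ∀ {x y : C}, (x ⟶ y) → Q.obj x →ₗ[k] Y.obj y := fun {x y} u =>
    (act X u ∘ₗ l x - l y ∘ₗ act Q u).codRestrict (LinearMap.ker (e.app y).hom) fun v => by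
      rw [LinearMap.mem_ker, LinearMap.sub_apply, map_sub, LinearMap.comp_apply,
        LinearMap.comp_apply, app_act, hl, hl, app_act, sub_self]
  have hδ : ∀ {x y z t : C} (f : x ⟶ y) [IsIso f] (u : y ⟶ z) (g : z ⟶ t) [IsIso g] (v),
      δ (f ≫ u ≫ g) v = act Y g (δ u (act Q f v)) := by
    intro x y z t f _ u g _ v
    refine Subtype.ext ?_
    change act X (f ≫ u ≫ g) (l x v) - l t (act Q (f ≫ u ≫ g) v) =
      act X g (act X u (l y (act Q f v)) - l z (act Q u (act Q f v)))
    rw [map_sub, hliso f, act_comp, act_comp, act_comp, act_comp, hliso g]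
  obtain ⟨T, hT, hTiso⟩ := exists_extension_commuting_with_isos hA hB i hi δ hδ
  obtain ⟨m, hmiso, hmunf⟩ := exists_coboundary hFFP hUFP hP T
    (fun {x y z} g _ f v hf => by
      have := hTiso g f (𝟙 z) hf.1 v
      rwa [Category.comp_id, act_id] at this)
    (fun {x y z} f g _ v hf => by
      have := hTiso (𝟙 x) f g hf.1 v
      rwa [Category.id_comp, act_id] at this)
  let ψ : ∀ x, Q.obj x →ₗ[k] X.obj x := fun x =>
    l x + (LinearMap.ker (e.app x).hom).subtype ∘ₗ m x ∘ₗ (i.app x).hom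
  have hψ : ∀ x v, ψ x v = l x v + (m x ((i.app x).hom v)).1 := fun _ _ => rfl
  have hψiso : ∀ {x y : C} (f : x ⟶ y) [IsIso f] (v), ψ y (act Q f v) = act X f (ψ x v) := by
    intro x y f _ v
    rw [hψ, hψ, hliso, app_act, hmiso, map_add]
    rfl
  have hψunf : ∀ {x y : C} (f : x ⟶ y) (v), Unfactorisable f →
      ψ y (act Q f v) = act X f (ψ x v) := by
    intro x y f v hf
    rw [hψ, hψ, app_act, hmunf f _ hf, hT f hf.1, map_add]
    change l y (act Q f v) + (act X f (m x ((i.app x).hom v)).1 +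
      (act X f (l x v) - l y (act Q f v))) = _
    abel
  have hψnat : ∀ {x y : C} (f : x ⟶ y) (v), ψ y (act Q f v) = act X f (ψ x v) := by
    intro x y f
    induction hFFP.isComposite f with
    | iso f hf => exact hψiso f
    | cons u f hu _ ih =>
      intro v
      rw [act_comp, act_comp, ih, hψunf u v hu]
  refine ⟨homOf ψ hψnat, ?_⟩
  ext x v
  change (e.app x).hom (ψ x v) = (φ.app x).hom v
  rw [hψ, map_add, hl, LinearMap.mem_ker.1 (m x ((i.app x).hom v)).2, add_zero]

end Sufficiency

end EITheory

theorem theoremC (k : Type w) [CommRing k] [IsSemisimpleRing k] [Nontrivial k]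
    (C : Type u) [Category.{v} C] [EITheory.IsEI C] (hFFP : EITheory.FFP C) :
    EITheory.IsHereditary (EITheory.LeftModules k C) ↔
      (∀ c : C, EITheory.IsHereditary (EITheory.GroupRingModules k c)) ∧
      EITheory.UFP C ∧
      (EITheory.ConditionA C k ∧ EITheory.ConditionB C k) := by
  refine ⟨fun h => ?_, fun ⟨hG, hUFP, hA, hB⟩ =>
    EITheory.isHereditary_of_conditions hFFP hG hUFP hA hB⟩
  have hC : EITheory.UniqueFirstFactors C := h.uniqueFirstFactors hFFP
  have hB := h.conditionB hFFP hC
  exact ⟨h.groupRingModules, hC.ufp hFFP, h.conditionA hB, hB⟩
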